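/- Let $d,n\in\mathbb N$, let $A_1,\dots,A_n$ be real symmetric positive definite $d\times d$ matrices, $\mu_i=N(0,A_i)$ the centered Gaussian measures on $\mathbb R^d$ with covariance $A_i$, $\lambda_1,\dots,\lambda_n\ge 0$ with $\sum_i\lambda_i=1$, and $\gamma>0$. Let $\mathcal P_2(\mathbb R^d)$ be the set of Borel probability measures on $\mathbb R^d$ with finite second moment, $W_2$ the $L^2$-Wasserstein distance, and $F(\mu)=\int p\log p\,dx$ if $\mu$ has Lebesgue density $p$, $F(\mu)=+\infty$ otherwise (so $F:\mathcal P_2(\mathbb R^d)\to(-\infty,+\infty]$). Put $$J(\mu)=\sum_{i=1}^n\tfrac12\lambda_iW_2^2(\mu,\mu_i)+\gamma F(\mu)$$ and, for positive definite $X$, $$f(X)=\sum_{i=1}^n\lambda_i\,\mathrm{tr}A_i+\sum_{i=1}^n\lambda_i\,\mathrm{tr}\Big(X-2\big(A_i^{1/2}XA_i^{1/2}\big)^{1/2}\Big)-\gamma\log\det X-\gamma d\log(2\pi e).$$ Then: 1. The equation $X-\gamma I=\sum_{i=1}^n\lambda_i\,(X^{1/2}A_iX^{1/2})^{1/2}$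 has exactly one positive definite solution $X$. 2. For every $\mathcal A\subseteq\mathcal P_2(\mathbb R^d)$ that contains all centered Gaussians with positive definite covariance (for instance the set of all Gaussian measures with positive definite covariance, or $\mathcal P_2(\mathbb R^d)$ itself), the problem $\min_{\mu\in\mathcal A}J(\mu)$ has exactly one minimizer, namely $N(0,X)$ with this $X$. 3. $J(N(0,Z))=\tfrac12 f(Z)$ for every positive definite $Z$, and $f$ is strictly convex on the set of positive definite matrices. 4. If $d=1$ and $A_i=(a_i)$, then $$X=\frac14\left[\sum_{i=1}^n\lambda_ia_i^{1/2}+\Big(\big(\textstyle\sum_{i=1}^n\lambda_ia_i^{1/2}\big)^2+4\gamma\Big)^{1/2}\right]^2 .$$ -/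

import Mathlib

open MeasureTheory ProbabilityTheory
open scoped ENNReal MatrixOrder

noncomputable section

namespace WBary

/-- The space `𝒫₂(ℝᵈ)` of Borel probability measures with finite second moment. -/
def P2 (d : ℕ) : Set (Measure (EuclideanSpace ℝ (Fin d))) :=
  {μ | IsProbabilityMeasure μ ∧ ∫⁻ x, ENNReal.ofReal (‖x‖ ^ 2) ∂μ < ∞}

/-- The set `Γ(μ, ν)` of transport plans: measures on the product with marginals `μ` and `ν`
(automatically probability measures when `μ` is one). -/
def transportPlans {d : ℕ} (μ ν : Measure (EuclideanSpace ℝ (Fin d))) :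
    Set (Measure (EuclideanSpace ℝ (Fin d) × EuclideanSpace ℝ (Fin d))) :=
  {π | π.map Prod.fst = μ ∧ π.map Prod.snd = ν}

/-- The squared `L²`-Wasserstein distance `W₂²(μ, ν)`. -/
def W2sq {d : ℕ} (μ ν : Measure (EuclideanSpace ℝ (Fin d))) : ℝ≥0∞ :=
  ⨅ π ∈ transportPlans μ ν, ∫⁻ z, ENNReal.ofReal (‖z.1 - z.2‖ ^ 2) ∂π

/-- The Lebesgue density of `μ` (meaningful when `μ ≪ volume`). -/
def density {d : ℕ} (μ : Measure (EuclideanSpace ℝ (Fin d))) (x : EuclideanSpace ℝ (Fin d)) : ℝ :=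
  (μ.rnDeriv volume x).toReal

open Classical in
/-- The negative Boltzmann entropy `∫ p log p` of `μ ∈ 𝒫₂(ℝᵈ)` with Lebesgue density `p`, with
values in `(-∞, +∞]`. It is `+∞` if `μ` has no density. On `𝒫₂(ℝᵈ)` the negative part of
`p log p` is always integrable, so if `p log p` is not integrable, its integral is `+∞`. -/
def boltzmannEntropy {d : ℕ} (μ : Measure (EuclideanSpace ℝ (Fin d))) : EReal :=
  if μ ≪ volume ∧ Integrable (fun x => density μ x * Real.log (density μ x)) volume then
    ((∫ x, density μ x * Real.log (density μ x) : ℝ) : EReal)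
  else ⊤

/-- The objective `∑ᵢ ½ λᵢ W₂²(μ, μᵢ) + γ F(μ)` of the penalized barycenter problem; here `w` are
the weights `λᵢ` and `m` the given measures `μᵢ`. -/
def penalizedObjective {d n : ℕ} (w : Fin n → ℝ)
    (m : Fin n → Measure (EuclideanSpace ℝ (Fin d))) (γ : ℝ)
    (μ : Measure (EuclideanSpace ℝ (Fin d))) : EReal :=
  ((∑ i, ENNReal.ofReal (w i / 2) * W2sq μ (m i) : ℝ≥0∞) : EReal) + (γ : EReal) * boltzmannEntropy μ

/-- The centered Gaussian measure `N(0, A)` on `ℝᵈ`. -/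
def centeredGaussian {d : ℕ} (A : Matrix (Fin d) (Fin d) ℝ) :
    Measure (EuclideanSpace ℝ (Fin d)) :=
  multivariateGaussian 0 A

/-- The reduced matrix objective
`f(X) = ∑ᵢ λᵢ tr Aᵢ + ∑ᵢ λᵢ tr (X - 2 (Aᵢ^½ X Aᵢ^½)^½) - γ log det X - γ d log (2 π e)`. -/
def matrixObjective {d n : ℕ} (w : Fin n → ℝ) (A : Fin n → Matrix (Fin d) (Fin d) ℝ) (γ : ℝ)
    (X : Matrix (Fin d) (Fin d) ℝ) : ℝ :=
  ∑ i, w i * (A i).trace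
    + ∑ i, w i * (X - (2 : ℝ) • CFC.sqrt (CFC.sqrt (A i) * X * CFC.sqrt (A i))).trace
    - γ * Real.log X.det - γ * d * Real.log (2 * Real.pi * Real.exp 1)

/-- `X` solves `X - γ I = ∑ᵢ λᵢ (X^½ Aᵢ X^½)^½`. -/
def SolvesBarycenterEq {d n : ℕ} (w : Fin n → ℝ) (A : Fin n → Matrix (Fin d) (Fin d) ℝ) (γ : ℝ)
    (X : Matrix (Fin d) (Fin d) ℝ) : Prop :=
  X - γ • (1 : Matrix (Fin d) (Fin d) ℝ)
    = ∑ i, w i • CFC.sqrt (CFC.sqrt X * A i * CFC.sqrt X)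

end WBary

end

/-! For `T` positive definite, completing the square gives `2 tr (A^½ Z A^½)^½ ≤ tr (T Z) + tr (T⁻¹
A)`, with equality when `T Z T = A`. With `T` frozen at its optimal value for `Y` and strict
concavity of `log det`, the reduced objective lies strictly above its tangent at `Y`, whose gradient
is `1 - ∑ wᵢ Tᵢ - γ Y⁻¹` (`matrixObjective_lt_of_ne`). This yields strict convexity and, since the
matrix equation is the gradient equation conjugated by `X^½`, uniqueness. Existence comes from a
compactness argument and a first-order variation along congruences `S X Sᵀ`.

For general measures the same `T` supplies quadratic Kantorovich potentials `‖x‖² - ⟪x, T x⟫` and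
`‖y‖² - ⟪y, T⁻¹ y⟫`, hence a lower bound on `W₂²`; Gibbs' inequality relative to `N(0, X)` bounds
the entropy. In the weighted sum all terms quadratic in `μ` cancel because `1 = ∑ wᵢ Tᵢ + γ X⁻¹`.
What remains is the constant `f(X) / 2`, and equality in Gibbs' inequality forces `μ = N(0, X)`
(`SolvesBarycenterEq.le_penalizedObjective`). -/

namespace Matrix

/-! ### Transport matrices and trace and determinant inequalities. -/

theorem PosDef.transpose_eq {ι : Type*} {A : Matrix ι ι ℝ} (hA : A.PosDef) : Aᵀ = A := by
  simpa [IsHermitian, conjTranspose_eq_transpose_of_trivial] using hA.isHermitian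

variable {ι : Type*} [Fintype ι] [DecidableEq ι]

theorem PosDef.sqrt_mul_sqrt {A : Matrix ι ι ℝ} (hA : A.PosDef) :
    CFC.sqrt A * CFC.sqrt A = A :=
  CFC.sqrt_mul_sqrt_self A hA.posSemidef.nonneg

theorem PosDef.sqrt_posDef {A : Matrix ι ι ℝ} (hA : A.PosDef) : (CFC.sqrt A).PosDef := by
  have h : (CFC.sqrt A).PosSemidef := nonneg_iff_posSemidef.1 (CFC.sqrt_nonneg A)
  refine h.posDef_iff_det_ne_zero.2 fun h0 => hA.det_pos.ne' ?_
  rw [← hA.sqrt_mul_sqrt, det_mul, h0, zero_mul]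

theorem PosDef.isUnit_det {A : Matrix ι ι ℝ} (hA : A.PosDef) : IsUnit A.det :=
  hA.det_pos.ne'.isUnit

theorem PosDef.mul_mul_transpose {A B : Matrix ι ι ℝ} (hA : A.PosDef) (hB : IsUnit B.det) :
    (B * A * Bᵀ).PosDef := by
  have h : (B * A * Bᵀ).PosSemidef := by
    simpa [conjTranspose_eq_transpose_of_trivial] using hA.posSemidef.mul_mul_conjTranspose_same B
  refine h.posDef_iff_det_ne_zero.2 ?_
  simp [det_mul, hA.det_pos.ne', hB.ne_zero]

theorem PosDef.conj_posDef {A B : Matrix ι ι ℝ} (hA : A.PosDef) (hB : B.PosDef) :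
    (B * A * B).PosDef := by
  simpa [hB.transpose_eq] using hA.mul_mul_transpose hB.isUnit_det

theorem PosSemidef.trace_mul_nonneg {P Q : Matrix ι ι ℝ} (hP : P.PosSemidef) (hQ : Q.PosSemidef) :
    0 ≤ (P * Q).trace := by
  have h : (CFC.sqrt Q)ᴴ = CFC.sqrt Q := (nonneg_iff_posSemidef.1 (CFC.sqrt_nonneg Q)).isHermitian
  have h1 := (hP.conjTranspose_mul_mul_same (CFC.sqrt Q)).trace_nonneg
  rwa [h, trace_mul_cycle, CFC.sqrt_mul_sqrt_self Q hQ.nonneg, trace_mul_comm] at h1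

/-- `T` is the optimal transport matrix from `N(0, Z)` to `N(0, A)`. -/
structure IsTransport (T Z A : Matrix ι ι ℝ) : Prop where
  posDef : T.PosDef
  conj : T * Z * T = A

theorem exists_isTransport {Z A : Matrix ι ι ℝ} (hZ : Z.PosDef) (hA : A.PosDef) :
    ∃ T, IsTransport T Z A ∧
      (T * Z).trace = (CFC.sqrt (CFC.sqrt A * Z * CFC.sqrt A)).trace := by
  set R := CFC.sqrt A with hR
  have hRp : R.PosDef := hA.sqrt_posDef
  have hM : (R * Z * R).PosDef := hZ.conj_posDef hRp
  set Q := CFC.sqrt (R * Z * R) with hQ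
  have hQp : Q.PosDef := hM.sqrt_posDef
  have hQQ : Q * Q = R * Z * R := hM.sqrt_mul_sqrt
  have hQ1 : Q⁻¹ * Q = 1 := nonsing_inv_mul _ hQp.isUnit_det
  have hQ2 : Q * Q⁻¹ = 1 := mul_nonsing_inv _ hQp.isUnit_det
  -- The classical formula `T = A^½ (A^½ Z A^½)^{-½} A^½`.
  refine ⟨R * Q⁻¹ * R, ⟨hQp.inv.conj_posDef hRp, ?_⟩, ?_⟩
  · calc R * Q⁻¹ * R * Z * (R * Q⁻¹ * R) = R * (Q⁻¹ * (R * Z * R) * Q⁻¹) * R := by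
          simp only [mul_assoc]
      _ = R * R := by
          rw [← hQQ, ← mul_assoc Q⁻¹, hQ1, one_mul, hQ2, mul_one]
      _ = A := hA.sqrt_mul_sqrt
  · calc (R * Q⁻¹ * R * Z).trace = ((Q⁻¹ * (R * Z)) * R).trace := by
          rw [trace_mul_comm _ R]; simp only [mul_assoc]
      _ = (Q⁻¹ * (R * Z * R)).trace := by simp only [mul_assoc]
      _ = Q.trace := by rw [← hQQ, ← mul_assoc, hQ1, one_mul]

theorem IsTransport.inv_mul {T Z A : Matrix ι ι ℝ} (h : IsTransport T Z A) : T⁻¹ * A = Z * T := by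
  rw [← h.conj, ← mul_assoc, ← mul_assoc, nonsing_inv_mul _ h.posDef.isUnit_det, one_mul]

theorem IsTransport.sqrt_conj {T Z A : Matrix ι ι ℝ} (h : IsTransport T Z A) (hZ : Z.PosDef) :
    CFC.sqrt (CFC.sqrt Z * A * CFC.sqrt Z) = CFC.sqrt Z * T * CFC.sqrt Z := by
  refine CFC.sqrt_unique ?_ (h.posDef.conj_posDef hZ.sqrt_posDef).posSemidef.nonneg
  rw [← h.conj]
  -- The sixth occurrence is the bare `Z` inside `T * Z * T`; the others sit under square roots.
  nth_rewrite 6 [← hZ.sqrt_mul_sqrt]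
  simp only [mul_assoc]

/-- Completing the square. -/
theorem IsTransport.two_mul_trace_le {T₀ X A : Matrix ι ι ℝ} (h : IsTransport T₀ X A)
    (hX : X.PosDef) {T : Matrix ι ι ℝ} (hT : T.PosDef) (S : Matrix ι ι ℝ) :
    2 * (S * X * T₀).trace ≤ (T * (S * X * Sᵀ)).trace + (T⁻¹ * A).trace := by
  -- The square being completed is this matrix paired with `T⁻¹` under the trace.
  have hN : ((T * S - T₀) * X * (T * S - T₀)ᵀ).PosSemidef := by
    simpa [conjTranspose_eq_transpose_of_trivial] using
      hX.posSemidef.mul_mul_conjTranspose_same (T * S - T₀)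
  have h0 := hN.trace_mul_nonneg hT.inv.posSemidef
  have hT1 : T⁻¹ * T = 1 := nonsing_inv_mul _ hT.isUnit_det
  have hT2 : T * T⁻¹ = 1 := mul_nonsing_inv _ hT.isUnit_det
  have e : (T * S - T₀) * X * (T * S - T₀)ᵀ * T⁻¹
      = T * (S * X * Sᵀ) - T * (S * X * T₀) * T⁻¹ - T₀ * X * Sᵀ + A * T⁻¹ := by
    rw [transpose_sub, transpose_mul, hT.transpose_eq, h.posDef.transpose_eq, ← h.conj]
    simp only [sub_mul, mul_sub, mul_assoc, hT2, mul_one]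
    abel
  have e1 : (T * (S * X * T₀) * T⁻¹).trace = (S * X * T₀).trace := by
    rw [trace_mul_comm, ← mul_assoc, hT1, one_mul]
  have e2 : (T₀ * X * Sᵀ).trace = (S * X * T₀).trace := by
    rw [← trace_transpose]
    simp [transpose_mul, h.posDef.transpose_eq, hX.transpose_eq, mul_assoc]
  rw [e, trace_add, trace_sub, trace_sub, e1, e2, trace_mul_comm A] at h0
  linarith

theorem two_mul_trace_sqrt_le {Z A T : Matrix ι ι ℝ} (hZ : Z.PosDef) (hA : A.PosDef)
    (hT : T.PosDef) :
    2 * (CFC.sqrt (CFC.sqrt A * Z * CFC.sqrt A)).trace ≤ (T * Z).trace + (T⁻¹ * A).trace := by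
  obtain ⟨T₀, h, ht⟩ := exists_isTransport hZ hA
  have := h.two_mul_trace_le hZ hT 1
  simp only [one_mul, transpose_one, mul_one] at this
  rwa [trace_mul_comm, ht] at this

/-- Uniqueness of the transport matrix is not needed: completing the square with either matrix as
reference gives the two opposite inequalities. -/
theorem IsTransport.trace_eq {T Z A : Matrix ι ι ℝ} (h : IsTransport T Z A) (hZ : Z.PosDef)
    (hA : A.PosDef) :
    (CFC.sqrt (CFC.sqrt A * Z * CFC.sqrt A)).trace = (T * Z).trace := by
  obtain ⟨T₁, h₁, ht⟩ := exists_isTransport hZ hA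
  have i1 := h.two_mul_trace_le hZ h₁.posDef 1
  have i2 := h₁.two_mul_trace_le hZ h.posDef 1
  simp only [one_mul, transpose_one, mul_one, h.inv_mul, h₁.inv_mul] at i1 i2
  rw [trace_mul_comm Z T, trace_mul_comm Z T₁] at i1 i2
  linarith

/-- A minorant linear in `S`, exact at `S = 1`. It replaces differentiation of the matrix square
root in the first-order condition. -/
theorem IsTransport.trace_le_trace_sqrt {T X A S : Matrix ι ι ℝ} (h : IsTransport T X A)
    (hX : X.PosDef) (hA : A.PosDef) (hS : IsUnit S.det) :
    (S * X * T).trace ≤ (CFC.sqrt (CFC.sqrt A * (S * X * Sᵀ) * CFC.sqrt A)).trace := by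
  obtain ⟨T₁, h₁, ht⟩ := exists_isTransport (hX.mul_mul_transpose hS) hA
  have := h.two_mul_trace_le hX h₁.posDef S
  rw [h₁.inv_mul, trace_mul_comm _ T₁, ht] at this
  linarith

/-- Sum `log t ≤ t - 1` over the eigenvalues. -/
theorem PosDef.log_det_le {P : Matrix ι ι ℝ} (hP : P.PosDef) :
    Real.log P.det ≤ P.trace - Fintype.card ι := by
  rw [hP.isHermitian.det_eq_prod_eigenvalues, hP.isHermitian.trace_eq_sum_eigenvalues]
  simp only [RCLike.ofReal_real_eq_id, id]
  rw [Real.log_prod fun i _ => (hP.eigenvalues_pos i).ne']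
  refine (Finset.sum_le_sum fun i _ => Real.log_le_sub_one_of_pos (hP.eigenvalues_pos i)).trans ?_
  simp

theorem PosDef.log_det_lt {P : Matrix ι ι ℝ} (hP : P.PosDef) (h1 : P ≠ 1) :
    Real.log P.det < P.trace - Fintype.card ι := by
  have : ∃ i, hP.isHermitian.eigenvalues i ≠ 1 := by
    by_contra! hall
    apply h1
    rw [hP.isHermitian.spectral_theorem]
    have : (RCLike.ofReal ∘ hP.isHermitian.eigenvalues : ι → ℝ) = fun _ => 1 := by
      ext i; simp [hall i]
    rw [this, diagonal_one, map_one]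
  obtain ⟨i, hi⟩ := this
  rw [hP.isHermitian.det_eq_prod_eigenvalues, hP.isHermitian.trace_eq_sum_eigenvalues]
  simp only [RCLike.ofReal_real_eq_id, id]
  rw [Real.log_prod fun i _ => (hP.eigenvalues_pos i).ne']
  refine (Finset.sum_lt_sum (fun i _ => Real.log_le_sub_one_of_pos (hP.eigenvalues_pos i))
    ⟨i, Finset.mem_univ i, Real.log_lt_sub_one_of_pos (hP.eigenvalues_pos i) hi⟩).trans_le ?_
  simp

/-- Strict concavity of `log det`, in tangent form. -/
theorem PosDef.log_det_lt_tangent {Y Z : Matrix ι ι ℝ} (hY : Y.PosDef) (hZ : Z.PosDef)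
    (h : Z ≠ Y) :
    Real.log Z.det < Real.log Y.det + (Y⁻¹ * (Z - Y)).trace := by
  set R := CFC.sqrt Y with hR
  have hRp : R.PosDef := hY.sqrt_posDef
  have hRR : R * R = Y := hY.sqrt_mul_sqrt
  have h1 : R⁻¹ * R = 1 := nonsing_inv_mul _ hRp.isUnit_det
  have h2 : R * R⁻¹ = 1 := mul_nonsing_inv _ hRp.isUnit_det
  have hYY : Y⁻¹ * Y = 1 := nonsing_inv_mul _ hY.isUnit_det
  have hYi : Y⁻¹ = R⁻¹ * R⁻¹ := by rw [← hRR, Matrix.mul_inv_rev]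
  -- Normalising by `Y^{-½}` moves the point of tangency to the identity.
  have hP : (R⁻¹ * Z * R⁻¹).PosDef := hZ.conj_posDef hRp.inv
  have hne : R⁻¹ * Z * R⁻¹ ≠ 1 := by
    intro hc
    apply h
    calc Z = R * (R⁻¹ * Z * R⁻¹) * R := by
          simp only [mul_assoc, h1, mul_one]; rw [← mul_assoc, h2, one_mul]
      _ = Y := by rw [hc, mul_one, hRR]
  have hlt := hP.log_det_lt hne
  have hdet : (R⁻¹ * Z * R⁻¹).det = Z.det * Y.det⁻¹ := by
    have : Y.det⁻¹ = R⁻¹.det * R⁻¹.det := by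
      rw [← det_mul, ← hYi, det_nonsing_inv, Ring.inverse_eq_inv']
    rw [det_mul, det_mul, this]; ring
  rw [hdet, Real.log_mul hZ.det_pos.ne' (inv_ne_zero hY.det_pos.ne'), Real.log_inv,
    trace_mul_comm, ← mul_assoc, ← hYi] at hlt
  rw [mul_sub, hYY, trace_sub, trace_one]
  linarith

end Matrix

/-! ### Tangent bounds, strict convexity and uniqueness for the reduced objective. -/

namespace WBary

open Matrix

variable {d n : ℕ} {w : Fin n → ℝ} {A : Fin n → Matrix (Fin d) (Fin d) ℝ} {γ : ℝ}

theorem matrixObjective_eq (hw1 : ∑ i, w i = 1) (X : Matrix (Fin d) (Fin d) ℝ) :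
    matrixObjective w A γ X = ∑ i, w i * (A i).trace + X.trace
      - 2 * ∑ i, w i * (CFC.sqrt (CFC.sqrt (A i) * X * CFC.sqrt (A i))).trace
      - γ * Real.log X.det - γ * d * Real.log (2 * Real.pi * Real.exp 1) := by
  have h : ∑ i, w i * (X - (2 : ℝ) • CFC.sqrt (CFC.sqrt (A i) * X * CFC.sqrt (A i))).trace
      = X.trace - 2 * ∑ i, w i * (CFC.sqrt (CFC.sqrt (A i) * X * CFC.sqrt (A i))).trace := by
    simp only [trace_sub, trace_smul, mul_sub, Finset.sum_sub_distrib, ← Finset.sum_mul, hw1,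
      one_mul, smul_eq_mul, Finset.mul_sum]
    congr 1
    exact Finset.sum_congr rfl fun i _ => by ring
  rw [matrixObjective, h]
  ring

/-- The matrix objective lies strictly above an affine function touching it at `Y`. -/
theorem matrixObjective_lt_of_ne (hw : ∀ i, 0 ≤ w i) (hw1 : ∑ i, w i = 1) (hγ : 0 < γ)
    (hA : ∀ i, (A i).PosDef) {Y Z : Matrix (Fin d) (Fin d) ℝ} (hY : Y.PosDef) (hZ : Z.PosDef)
    (hne : Z ≠ Y) {T : Fin n → Matrix (Fin d) (Fin d) ℝ} (hT : ∀ i, IsTransport (T i) Y (A i)) :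
    matrixObjective w A γ Y + ((1 - ∑ i, w i • T i - γ • Y⁻¹) * (Z - Y)).trace
      < matrixObjective w A γ Z := by
  -- The `T i` are optimal at `Y` but only admissible at `Z`: inequality here, equality in `hY'`.
  have hs : ∑ i, w i * (2 * (CFC.sqrt (CFC.sqrt (A i) * Z * CFC.sqrt (A i))).trace) ≤
      ∑ i, w i * ((T i * Z).trace + (T i * Y).trace) := by
    refine Finset.sum_le_sum fun i _ => mul_le_mul_of_nonneg_left ?_ (hw i)
    have := two_mul_trace_sqrt_le hZ (hA i) (hT i).posDef
    rwa [(hT i).inv_mul, trace_mul_comm Y] at this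
  have hY' : ∑ i, w i * (2 * (CFC.sqrt (CFC.sqrt (A i) * Y * CFC.sqrt (A i))).trace) =
      ∑ i, w i * (2 * (T i * Y).trace) :=
    Finset.sum_congr rfl fun i _ => by rw [(hT i).trace_eq hY (hA i)]
  have hl := mul_lt_mul_of_pos_left (hY.log_det_lt_tangent hZ hne) hγ
  have e : ((1 - ∑ i, w i • T i - γ • Y⁻¹) * (Z - Y)).trace = Z.trace - Y.trace
      - (∑ i, w i * (T i * Z).trace - ∑ i, w i * (T i * Y).trace)
      - γ * (Y⁻¹ * (Z - Y)).trace := by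
    rw [sub_mul, sub_mul, one_mul, Finset.sum_mul, trace_sub, trace_sub, trace_sub, trace_sum,
      smul_mul, trace_smul, smul_eq_mul, ← Finset.sum_sub_distrib]
    congr 2
    exact Finset.sum_congr rfl fun i _ => by
      rw [smul_mul, trace_smul, mul_sub, trace_sub, smul_eq_mul, mul_sub]
  rw [matrixObjective_eq hw1, matrixObjective_eq hw1, e]
  simp only [mul_add, Finset.sum_add_distrib] at hs hl
  simp only [mul_left_comm _ (2 : ℝ), ← Finset.mul_sum] at hs hY'
  linarith

theorem exists_transports (hA : ∀ i, (A i).PosDef) {Y : Matrix (Fin d) (Fin d) ℝ}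
    (hY : Y.PosDef) : ∃ T : Fin n → Matrix (Fin d) (Fin d) ℝ, ∀ i, IsTransport (T i) Y (A i) := by
  choose T hT _ using fun i => exists_isTransport hY (hA i)
  exact ⟨T, hT⟩

/-- Apply the strict tangent bound at `a • X + b • Y` to both endpoints; in the weighted sum the
linear terms cancel. -/
theorem strictConvexOn_matrixObjective (hw : ∀ i, 0 ≤ w i) (hw1 : ∑ i, w i = 1) (hγ : 0 < γ)
    (hA : ∀ i, (A i).PosDef) :
    StrictConvexOn ℝ {Z : Matrix (Fin d) (Fin d) ℝ | Z.PosDef} (matrixObjective w A γ) := by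
  have hconv : Convex ℝ {Z : Matrix (Fin d) (Fin d) ℝ | Z.PosDef} := by
    refine convex_iff_forall_pos.2 fun X hX Y hY a b ha hb _ => ?_
    exact (PosDef.smul hX ha).add (PosDef.smul hY hb)
  refine ⟨hconv, fun X hX Y hY hne a b ha hb hab => ?_⟩
  have hW : (a • X + b • Y).PosDef := hconv hX hY ha.le hb.le hab
  obtain ⟨T, hT⟩ := exists_transports hA hW
  have hXW : X - (a • X + b • Y) = b • (X - Y) := by
    rw [← sub_eq_of_eq_add' hab.symm]; module
  have hYW : Y - (a • X + b • Y) = -(a • (X - Y)) := by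
    rw [← sub_eq_of_eq_add' hab.symm]; module
  have hnX : X ≠ a • X + b • Y := by
    rw [← sub_ne_zero, hXW]; exact smul_ne_zero hb.ne' (sub_ne_zero.2 hne)
  have hnY : Y ≠ a • X + b • Y := by
    rw [← sub_ne_zero, hYW]; exact neg_ne_zero.2 (smul_ne_zero ha.ne' (sub_ne_zero.2 hne))
  have h1 := mul_lt_mul_of_pos_left (matrixObjective_lt_of_ne hw hw1 hγ hA hW hX hnX hT) ha
  have h2 := mul_lt_mul_of_pos_left (matrixObjective_lt_of_ne hw hw1 hγ hA hW hY hnY hT) hb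
  rw [hXW, Matrix.mul_smul, trace_smul, smul_eq_mul] at h1
  rw [hYW, mul_neg, Matrix.mul_smul, trace_neg, trace_smul, smul_eq_mul] at h2
  have hb' : b = 1 - a := by linarith
  simp only [smul_eq_mul]
  set W := a • X + b • Y with hWdef
  set D := ((1 - ∑ i, w i • T i - γ • W⁻¹) * (X - Y)).trace
  have : matrixObjective w A γ W = a * (matrixObjective w A γ W + b * D)
      + b * (matrixObjective w A γ W + -(a * D)) := by
    subst hb'; ring
  linarith

/-- The matrix equation in terms of transport matrices. -/
theorem solvesBarycenterEq_iff {X : Matrix (Fin d) (Fin d) ℝ} (hX : X.PosDef)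
    {T : Fin n → Matrix (Fin d) (Fin d) ℝ} (hT : ∀ i, IsTransport (T i) X (A i)) :
    SolvesBarycenterEq w A γ X ↔ 1 - ∑ i, w i • T i - γ • X⁻¹ = 0 := by
  set R := CFC.sqrt X with hR
  have hRp : R.PosDef := hX.sqrt_posDef
  have hRR : R * R = X := hX.sqrt_mul_sqrt
  have h1 : R⁻¹ * R = 1 := nonsing_inv_mul _ hRp.isUnit_det
  have h2 : R * R⁻¹ = 1 := mul_nonsing_inv _ hRp.isUnit_det
  have hXi : X⁻¹ = R⁻¹ * R⁻¹ := by rw [← hRR, Matrix.mul_inv_rev]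
  -- Conjugating the gradient by the invertible `R = X^½` gives exactly the defect of the matrix
  -- equation.
  have key : R * (1 - ∑ i, w i • T i - γ • X⁻¹) * R
      = X - γ • 1 - ∑ i, w i • CFC.sqrt (R * A i * R) := by
    have hs : ∑ i, w i • CFC.sqrt (R * A i * R) = R * (∑ i, w i • T i) * R := by
      rw [Finset.mul_sum, Finset.sum_mul]
      exact Finset.sum_congr rfl fun i _ => by
        rw [(hT i).sqrt_conj hX, Matrix.mul_smul, smul_mul]
    have hi : R * (γ • X⁻¹) * R = γ • 1 := by
      rw [Matrix.mul_smul, smul_mul, hXi, ← mul_assoc, h2, one_mul, h1]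
    rw [mul_sub, mul_sub, sub_mul, sub_mul, hi, hs, mul_one, hRR]
    abel
  rw [SolvesBarycenterEq, ← sub_eq_zero, ← hR, ← key]
  constructor
  · intro h
    calc _ = R⁻¹ * (R * (1 - ∑ i, w i • T i - γ • X⁻¹) * R) * R⁻¹ := by
          rw [← mul_assoc, ← mul_assoc, h1, one_mul, mul_assoc _ R, h2, mul_one]
      _ = 0 := by rw [h, mul_zero, zero_mul]
  · intro h
    rw [h, mul_zero, zero_mul]

theorem SolvesBarycenterEq.lt (hw : ∀ i, 0 ≤ w i) (hw1 : ∑ i, w i = 1) (hγ : 0 < γ)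
    (hA : ∀ i, (A i).PosDef) {X Z : Matrix (Fin d) (Fin d) ℝ} (hX : X.PosDef)
    (h : SolvesBarycenterEq w A γ X) (hZ : Z.PosDef) (hne : Z ≠ X) :
    matrixObjective w A γ X < matrixObjective w A γ Z := by
  obtain ⟨T, hT⟩ := exists_transports hA hX
  have := matrixObjective_lt_of_ne hw hw1 hγ hA hX hZ hne hT
  rwa [(solvesBarycenterEq_iff hX hT).1 h, zero_mul, trace_zero, add_zero] at this

theorem SolvesBarycenterEq.unique (hw : ∀ i, 0 ≤ w i) (hw1 : ∑ i, w i = 1) (hγ : 0 < γ)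
    (hA : ∀ i, (A i).PosDef) {X Y : Matrix (Fin d) (Fin d) ℝ} (hX : X.PosDef)
    (h : SolvesBarycenterEq w A γ X) (hY : Y.PosDef) (h' : SolvesBarycenterEq w A γ Y) :
    Y = X := by
  by_contra hne
  exact lt_asymm (h.lt hw hw1 hγ hA hX hY hne) (h'.lt hw hw1 hγ hA hY hX (Ne.symm hne))

end WBary

/-! ### Existence of a solution of the matrix equation. -/

namespace Matrix

theorem hasDerivAt_det_one_add_smul {ι : Type*} [Fintype ι] [DecidableEq ι] (H : Matrix ι ι ℝ) :
    HasDerivAt (fun t : ℝ => (1 + t • H).det) H.trace 0 := by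
  rw [funext fun t : ℝ => det_one_add_smul t H]
  set p := (det (1 + (Polynomial.X : Polynomial ℝ) • H.map Polynomial.C)).divX.divX
  have h := (((hasDerivAt_id (0 : ℝ)).const_mul H.trace).const_add 1).add
    ((p.hasDerivAt 0).mul ((hasDerivAt_id (0 : ℝ)).pow 2))
  exact h.congr_deriv (by simp)

theorem eq_zero_of_forall_trace_mul {ι : Type*} [Fintype ι] {G : Matrix ι ι ℝ}
    (h : ∀ H : Matrix ι ι ℝ, (H * G).trace = 0) : G = 0 := by
  have := h Gᴴ
  rwa [trace_conjTranspose_mul_self_eq_zero_iff] at this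

end Matrix

namespace WBary

open Matrix

variable {d n : ℕ} {w : Fin n → ℝ} {A : Fin n → Matrix (Fin d) (Fin d) ℝ} {γ : ℝ}

/-- On a sublevel set the first bound controls the trace from above, the second keeps the
determinant away from zero. -/
theorem exists_coercive_bound (hw : ∀ i, 0 ≤ w i) (hw1 : ∑ i, w i = 1) (hγ : 0 < γ)
    (hA : ∀ i, (A i).PosDef) :
    ∃ C : ℝ, ∀ Z : Matrix (Fin d) (Fin d) ℝ, Z.PosDef →
      Z.trace / 4 - C ≤ matrixObjective w A γ Z ∧
      -C - γ * Real.log Z.det ≤ matrixObjective w A γ Z := by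
  set a := ∑ i, w i * (A i).trace
  -- With this scale, `log_det_le` for `s • Z` bounds `γ log det Z` by `tr Z / 4` plus a constant,
  -- half of the `tr Z / 2` available in `base`.
  set s : ℝ := 1 / (4 * γ) with hs
  have hs0 : 0 < s := by positivity
  set c := γ * d * Real.log (2 * Real.pi * Real.exp 1)
  have base : ∀ Z : Matrix (Fin d) (Fin d) ℝ, Z.PosDef →
      Z.trace / 2 - a - γ * Real.log Z.det - c ≤ matrixObjective w A γ Z := by
    intro Z hZ
    have h : ∑ i, w i * (2 * (CFC.sqrt (CFC.sqrt (A i) * Z * CFC.sqrt (A i))).trace) ≤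
        ∑ i, w i * (Z.trace / 2 + 2 * (A i).trace) := by
      refine Finset.sum_le_sum fun i _ => mul_le_mul_of_nonneg_left ?_ (hw i)
      -- Testing with `T = ½ I` costs only half of `tr Z`.
      have hT : ((1 / 2 : ℝ) • (1 : Matrix (Fin d) (Fin d) ℝ)).PosDef :=
        PosDef.smul PosDef.one (by norm_num)
      have hi : ((1 / 2 : ℝ) • (1 : Matrix (Fin d) (Fin d) ℝ))⁻¹ = (2 : ℝ) • 1 := by
        refine inv_eq_left_inv ?_
        rw [smul_mul_smul_comm, one_mul]; norm_num
      have := two_mul_trace_sqrt_le hZ (hA i) hT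
      rw [hi, smul_mul, smul_mul, one_mul, one_mul, trace_smul, trace_smul, smul_eq_mul,
        smul_eq_mul] at this
      linarith
    rw [matrixObjective_eq hw1]
    simp only [mul_add, Finset.sum_add_distrib, ← Finset.sum_mul, hw1, one_mul] at h
    simp only [mul_left_comm _ (2 : ℝ), ← Finset.mul_sum] at h
    linarith
  refine ⟨a + c + |γ * (-d - d * Real.log s)|, fun Z hZ => ?_⟩
  have hb := base Z hZ
  have hZt : 0 ≤ Z.trace := hZ.posSemidef.trace_nonneg
  have hlog := (PosDef.smul hZ hs0).log_det_le
  rw [det_smul, Real.log_mul (by positivity) hZ.det_pos.ne', Real.log_pow, trace_smul,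
    Fintype.card_fin, smul_eq_mul] at hlog
  have h2 := mul_le_mul_of_nonneg_left hlog hγ.le
  have h3 : γ * (s * Z.trace) = Z.trace / 4 := by rw [hs]; field_simp
  have h4 := le_abs_self (γ * (-d - d * Real.log s))
  have h5 := abs_nonneg (γ * (-d - d * Real.log s))
  constructor
  · nlinarith
  · nlinarith

/-- The trace of `B * Bᵀ` is the sum of the squared entries of `B`. -/
theorem isCompact_setOf_trace_le (R δ : ℝ) :
    IsCompact {B : Matrix (Fin d) (Fin d) ℝ | (B * Bᵀ).trace ≤ R ∧ δ ≤ (B * Bᵀ).det} := by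
  have hbox : IsCompact (Set.univ.pi fun _ : Fin d => Set.univ.pi fun _ : Fin d =>
      Set.Icc (-√R) (√R)) :=
    isCompact_univ_pi fun _ => isCompact_univ_pi fun _ => isCompact_Icc
  have hcl : IsClosed {B : Matrix (Fin d) (Fin d) ℝ | (B * Bᵀ).trace ≤ R ∧ δ ≤ (B * Bᵀ).det} :=
    (isClosed_le (f := fun B : Matrix (Fin d) (Fin d) ℝ => (B * Bᵀ).trace) (by fun_prop)
      continuous_const).inter (isClosed_le (g := fun B : Matrix (Fin d) (Fin d) ℝ => (B * Bᵀ).det)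
      continuous_const (by fun_prop))
  refine hbox.of_isClosed_subset hcl fun B hB i _ j _ => ?_
  have h : B i j ^ 2 ≤ R := by
    refine le_trans ?_ hB.1
    change _ ≤ ∑ k, ∑ l, B k l * B k l
    calc B i j ^ 2 = B i j * B i j := sq _
      _ ≤ ∑ l, B i l * B i l := Finset.single_le_sum (f := fun l => B i l * B i l)
          (fun l _ => mul_self_nonneg _) (Finset.mem_univ j)
      _ ≤ _ := Finset.single_le_sum (f := fun k => ∑ l, B k l * B k l)
          (fun k _ => Finset.sum_nonneg fun l _ => mul_self_nonneg _) (Finset.mem_univ i)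
  exact abs_le.1 (Real.abs_le_sqrt h)

theorem posDef_mul_transpose_self {B : Matrix (Fin d) (Fin d) ℝ} (hB : IsUnit B.det) :
    (B * Bᵀ).PosDef := by
  simpa using (PosDef.one (R := ℝ) (n := Fin d)).mul_mul_transpose hB

/-- Direct method over factors `B` of `Z = B Bᵀ`: the constraints become closed polynomial
conditions, and a congruence by `S` just replaces `B` by `S * B`. -/
theorem exists_congruence_minimizer (hw : ∀ i, 0 ≤ w i) (hw1 : ∑ i, w i = 1) (hγ : 0 < γ)
    (hA : ∀ i, (A i).PosDef) :
    ∃ X : Matrix (Fin d) (Fin d) ℝ, X.PosDef ∧ ∀ S : Matrix (Fin d) (Fin d) ℝ, IsUnit S.det →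
      matrixObjective w A γ X ≤ matrixObjective w A γ (S * X * Sᵀ) := by
  obtain ⟨C, hC⟩ := exists_coercive_bound hw hw1 hγ hA
  set M := matrixObjective w A γ 1 with hM
  -- `R` and `δ` are what the two coercive bounds give on the sublevel set of `M`, the value at the
  -- identity.
  set R := 4 * (M + C)
  set δ := Real.exp (-(C + M) / γ)
  set K := {B : Matrix (Fin d) (Fin d) ℝ | (B * Bᵀ).trace ≤ R ∧ δ ≤ (B * Bᵀ).det}
  have hunit : ∀ B ∈ K, IsUnit B.det := by
    intro B hB
    have h : 0 < (B * Bᵀ).det := (Real.exp_pos _).trans_le hB.2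
    rw [det_mul] at h
    exact (left_ne_zero_of_mul h.ne').isUnit
  have hmem : ∀ B : Matrix (Fin d) (Fin d) ℝ, IsUnit B.det →
      matrixObjective w A γ (B * Bᵀ) ≤ M → B ∈ K := by
    intro B hB hle
    have hZ := posDef_mul_transpose_self hB
    obtain ⟨h1, h2⟩ := hC _ hZ
    refine ⟨by simp only [R]; linarith, ?_⟩
    rw [← Real.le_log_iff_exp_le hZ.det_pos, div_le_iff₀ hγ]
    linarith
  have h1K : (1 : Matrix (Fin d) (Fin d) ℝ) ∈ K := hmem 1 (by simp) (by simp [hM])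
  -- The tangent at `B * Bᵀ` is a continuous minorant touching there, so continuity of the matrix
  -- square root is not needed.
  have hlsc : LowerSemicontinuousOn
      (fun B : Matrix (Fin d) (Fin d) ℝ => matrixObjective w A γ (B * Bᵀ)) K := by
    intro B hB y hy
    obtain ⟨T, hT⟩ := exists_transports hA (posDef_mul_transpose_self (hunit B hB))
    set G := 1 - ∑ i, w i • T i - γ • (B * Bᵀ)⁻¹
    have hcont : Continuous fun B' : Matrix (Fin d) (Fin d) ℝ =>
        matrixObjective w A γ (B * Bᵀ) + (G * (B' * B'ᵀ - B * Bᵀ)).trace := by fun_prop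
    have hev := (hcont.tendsto B).eventually_const_lt (u := y) (by simpa using hy)
    filter_upwards [nhdsWithin_le_nhds hev, self_mem_nhdsWithin] with B' hB' hK
    refine hB'.trans_le ?_
    by_cases hne : B' * B'ᵀ = B * Bᵀ
    · simp [hne]
    · exact (matrixObjective_lt_of_ne hw hw1 hγ hA (posDef_mul_transpose_self (hunit B hB))
        (posDef_mul_transpose_self (hunit B' hK)) hne hT).le
  obtain ⟨B, hB, hmin⟩ := hlsc.exists_isMinOn ⟨1, h1K⟩ (isCompact_setOf_trace_le R δ)
  refine ⟨B * Bᵀ, posDef_mul_transpose_self (hunit B hB), fun S hS => ?_⟩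
  have e : S * (B * Bᵀ) * Sᵀ = (S * B) * (S * B)ᵀ := by
    simp only [transpose_mul, Matrix.mul_assoc]
  rw [e]
  by_cases hle : matrixObjective w A γ ((S * B) * (S * B)ᵀ) ≤ M
  · exact hmin (hmem (S * B) (by rw [det_mul]; exact hS.mul (hunit B hB)) hle)
  · have h1 : matrixObjective w A γ (B * Bᵀ) ≤ matrixObjective w A γ (1 * 1ᵀ) := hmin h1K
    rw [transpose_one, mul_one] at h1
    linarith

theorem exists_solvesBarycenterEq (hw : ∀ i, 0 ≤ w i) (hw1 : ∑ i, w i = 1) (hγ : 0 < γ)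
    (hA : ∀ i, (A i).PosDef) :
    ∃ X : Matrix (Fin d) (Fin d) ℝ, X.PosDef ∧ SolvesBarycenterEq w A γ X := by
  obtain ⟨X, hX, hmin⟩ := exists_congruence_minimizer hw hw1 hγ hA
  obtain ⟨T, hT⟩ := exists_transports hA hX
  refine ⟨X, hX, (solvesBarycenterEq_iff hX hT).2 ?_⟩
  -- Replacing the square-root term by its minorant linear in `S` yields an explicit competitor,
  -- still minimal at `S = 1`.
  have hS : ∀ S : Matrix (Fin d) (Fin d) ℝ, IsUnit S.det →
      X.trace - 2 * ∑ i, w i * (X * T i).trace ≤ (S * X * Sᵀ).trace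
        - 2 * ∑ i, w i * (S * X * T i).trace - 2 * γ * Real.log S.det := by
    intro S hS
    have h := hmin S hS
    have hs : ∑ i, w i * (S * X * T i).trace ≤
        ∑ i, w i * (CFC.sqrt (CFC.sqrt (A i) * (S * X * Sᵀ) * CFC.sqrt (A i))).trace :=
      Finset.sum_le_sum fun i _ => mul_le_mul_of_nonneg_left
        ((hT i).trace_le_trace_sqrt hX (hA i) hS) (hw i)
    have hX' : ∑ i, w i * (CFC.sqrt (CFC.sqrt (A i) * X * CFC.sqrt (A i))).trace =
        ∑ i, w i * (X * T i).trace :=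
      Finset.sum_congr rfl fun i _ => by rw [(hT i).trace_eq hX (hA i), trace_mul_comm]
    rw [matrixObjective_eq hw1, matrixObjective_eq hw1, hX', det_mul, det_mul, det_transpose,
      Real.log_mul (mul_ne_zero hS.ne_zero hX.det_pos.ne') hS.ne_zero,
      Real.log_mul hS.ne_zero hX.det_pos.ne'] at h
    linarith
  -- `X` times the gradient, the form in which the variation produces it.
  set G := X - ∑ i, w i • (X * T i) - γ • (1 : Matrix (Fin d) (Fin d) ℝ) with hG
  have hG0 : G = 0 := by
    refine eq_zero_of_forall_trace_mul fun H => ?_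
    have hHG : (H * G).trace =
        (H * X).trace - ∑ i, w i * (H * X * T i).trace - γ * H.trace := by
      simp only [hG, Matrix.mul_sub, trace_sub, Finset.mul_sum, trace_sum, Matrix.mul_smul,
        trace_smul, smul_eq_mul, mul_one, Matrix.mul_assoc]
    -- The competitor along `S = 1 + t • H`, with derivative `2 tr (H G)` at `0`.
    set φ : ℝ → ℝ := fun t => X.trace + 2 * t * (H * X).trace + t ^ 2 * (H * X * Hᵀ).trace
      - 2 * (∑ i, w i * (X * T i).trace + t * ∑ i, w i * (H * X * T i).trace)
      - 2 * γ * Real.log (1 + t • H).det with hφ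
    have hdet := hasDerivAt_det_one_add_smul H
    have hd0 : (1 + (0 : ℝ) • H).det = 1 := by simp
    have hunit : ∀ᶠ t in nhds (0 : ℝ), IsUnit (1 + t • H).det := by
      have := hdet.continuousAt.eventually_ne (y := 0) (by simp)
      exact this.mono fun t ht => ht.isUnit
    have hlocal : IsLocalMin φ 0 := by
      filter_upwards [hunit] with t ht
      have h := hS _ ht
      have e1 : ((1 + t • H) * X * (1 + t • H)ᵀ).trace =
          X.trace + 2 * t * (H * X).trace + t ^ 2 * (H * X * Hᵀ).trace := by
        have : (X * Hᵀ).trace = (H * X).trace := by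
          rw [← trace_transpose, transpose_mul, transpose_transpose, hX.transpose_eq]
        simp only [transpose_add, transpose_one, transpose_smul, add_mul, Matrix.mul_add, one_mul,
          mul_one, smul_mul, Matrix.mul_smul, trace_add, trace_smul, smul_eq_mul, this]
        ring
      have e2 : ∑ i, w i * ((1 + t • H) * X * T i).trace =
          ∑ i, w i * (X * T i).trace + t * ∑ i, w i * (H * X * T i).trace := by
        rw [Finset.mul_sum, ← Finset.sum_add_distrib]
        refine Finset.sum_congr rfl fun i _ => ?_
        simp only [add_mul, one_mul, smul_mul, trace_add, trace_smul, smul_eq_mul]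
        ring
      rw [e1, e2] at h
      simp only [hφ, hd0, Real.log_one]
      linarith
    have hderiv : HasDerivAt φ (2 * (H * G).trace) 0 := by
      have hid := hasDerivAt_id (0 : ℝ)
      have hl := hdet.log (by simp)
      have h := (((((hid.const_mul 2).mul_const (H * X).trace).const_add X.trace).add
        ((hid.pow 2).mul_const (H * X * Hᵀ).trace)).sub
        (((hid.mul_const (∑ i, w i * (H * X * T i).trace)).const_add
          (∑ i, w i * (X * T i).trace)).const_mul 2)).sub (hl.const_mul (2 * γ))
      refine h.congr_deriv ?_
      rw [hHG, hd0]
      simp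
      ring
    have := hlocal.hasDerivAt_eq_zero hderiv
    linarith
  have hXX : X⁻¹ * X = 1 := nonsing_inv_mul _ hX.isUnit_det
  calc 1 - ∑ i, w i • T i - γ • X⁻¹ = X⁻¹ * G := by
        simp only [hG, Matrix.mul_sub, Finset.mul_sum, Matrix.mul_smul, mul_one, ← Matrix.mul_assoc,
          hXX, one_mul]
    _ = 0 := by rw [hG0, mul_zero]

end WBary

/-! ### Quadratic forms, moments and densities of centered Gaussians. -/

namespace WBary

open Matrix
open scoped RealInnerProductSpace

variable {d : ℕ}

/-- The quadratic form `x ↦ ⟪x, T x⟫` of a matrix. -/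
noncomputable def quadForm (T : Matrix (Fin d) (Fin d) ℝ) (x : EuclideanSpace ℝ (Fin d)) : ℝ :=
  ⟪x, toEuclideanCLM (𝕜 := ℝ) T x⟫

theorem continuous_quadForm (T : Matrix (Fin d) (Fin d) ℝ) : Continuous (quadForm T) := by
  unfold quadForm
  fun_prop

theorem quadForm_eq_sum (T : Matrix (Fin d) (Fin d) ℝ) (x : EuclideanSpace ℝ (Fin d)) :
    quadForm T x = ∑ i, ∑ j, T i j * (x i * x j) := by
  rw [quadForm, inner_toEuclideanCLM]
  simp only [dotProduct, mulVec, Finset.mul_sum]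
  exact Finset.sum_congr rfl fun i _ => Finset.sum_congr rfl fun j _ => by ring

theorem quadForm_one (x : EuclideanSpace ℝ (Fin d)) : quadForm 1 x = ‖x‖ ^ 2 := by
  simp [quadForm]

theorem inner_toEuclideanCLM_left {T : Matrix (Fin d) (Fin d) ℝ} (hT : Tᵀ = T)
    (x y : EuclideanSpace ℝ (Fin d)) :
    ⟪toEuclideanCLM (𝕜 := ℝ) T x, y⟫ = ⟪x, toEuclideanCLM (𝕜 := ℝ) T y⟫ := by
  rw [real_inner_comm, inner_toEuclideanCLM, inner_toEuclideanCLM, dotProduct_mulVec,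
    ← mulVec_transpose, hT, dotProduct_comm]

theorem quadForm_conj {R : Matrix (Fin d) (Fin d) ℝ} (hR : Rᵀ = R)
    (M : Matrix (Fin d) (Fin d) ℝ) (x : EuclideanSpace ℝ (Fin d)) :
    quadForm M (toEuclideanCLM (𝕜 := ℝ) R x) = quadForm (R * M * R) x := by
  rw [quadForm, inner_toEuclideanCLM_left hR, quadForm, map_mul, map_mul]
  rfl

theorem norm_toEuclideanCLM_sq {R : Matrix (Fin d) (Fin d) ℝ} (hR : Rᵀ = R)
    (x : EuclideanSpace ℝ (Fin d)) :
    ‖toEuclideanCLM (𝕜 := ℝ) R x‖ ^ 2 = quadForm (R * R) x := by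
  rw [← quadForm_one, quadForm_conj hR, mul_one]

theorem integrable_quadForm {μ : Measure (EuclideanSpace ℝ (Fin d))}
    (hμ : Integrable (fun x => ‖x‖ ^ 2) μ) (T : Matrix (Fin d) (Fin d) ℝ) :
    Integrable (quadForm T) μ := by
  refine (hμ.const_mul ‖toEuclideanCLM (𝕜 := ℝ) T‖).mono'
    (continuous_quadForm T).aestronglyMeasurable (Filter.Eventually.of_forall fun x => ?_)
  calc ‖quadForm T x‖ ≤ ‖x‖ * ‖toEuclideanCLM (𝕜 := ℝ) T x‖ := norm_inner_le_norm _ _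
    _ ≤ ‖x‖ * (‖toEuclideanCLM (𝕜 := ℝ) T‖ * ‖x‖) := by
        gcongr; exact ContinuousLinearMap.le_opNorm _ _
    _ = _ := by ring

theorem integrable_norm_sq_of_mem_P2 {μ : Measure (EuclideanSpace ℝ (Fin d))} (hμ : μ ∈ P2 d) :
    Integrable (fun x => ‖x‖ ^ 2) μ :=
  ⟨by fun_prop, (hasFiniteIntegral_iff_ofReal
    (Filter.Eventually.of_forall fun x => by positivity)).2 hμ.2⟩

instance isProbabilityMeasure_centeredGaussian (A : Matrix (Fin d) (Fin d) ℝ) :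
    IsProbabilityMeasure (centeredGaussian A) := by
  unfold centeredGaussian
  infer_instance

theorem memLp_two_centeredGaussian (A : Matrix (Fin d) (Fin d) ℝ) :
    MemLp id 2 (centeredGaussian A) := by
  unfold centeredGaussian
  exact IsGaussian.memLp_two_id

theorem integrable_norm_sq_centeredGaussian (A : Matrix (Fin d) (Fin d) ℝ) :
    Integrable (fun x => ‖x‖ ^ 2) (centeredGaussian A) :=
  (memLp_two_centeredGaussian A).integrable_norm_pow two_ne_zero

theorem integral_mul_centeredGaussian {A : Matrix (Fin d) (Fin d) ℝ} (hA : A.PosDef)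
    (i j : Fin d) :
    Integrable (fun x : EuclideanSpace ℝ (Fin d) => x i * x j) (centeredGaussian A) ∧
      ∫ x, x i * x j ∂centeredGaussian A = A i j := by
  have hL : ∀ i, MemLp (fun x : EuclideanSpace ℝ (Fin d) => x i) 2 (centeredGaussian A) :=
    fun i => (memLp_two_centeredGaussian A).continuousLinearMap_comp
      (EuclideanSpace.proj (𝕜 := ℝ) i)
  have h0 : ∀ i, ∫ x, x i ∂centeredGaussian A = 0 := fun i => by
    have h := (EuclideanSpace.proj (𝕜 := ℝ) i).integral_comp_comm
      ((memLp_two_centeredGaussian A).integrable one_le_two)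
    have h' : ∫ x, x ∂centeredGaussian A = 0 := integral_id_multivariateGaussian
    simpa [h'] using h
  refine ⟨(hL i).integrable_mul (hL j), ?_⟩
  have h := covariance_eval_multivariateGaussian (μ := 0) hA.posSemidef i j
  change cov[_, _; centeredGaussian A] = _ at h
  rw [covariance_eq_sub (hL i) (hL j), h0, h0, mul_zero, sub_zero] at h
  exact h

theorem integral_quadForm_centeredGaussian {A : Matrix (Fin d) (Fin d) ℝ} (hA : A.PosDef)
    (T : Matrix (Fin d) (Fin d) ℝ) :
    ∫ x, quadForm T x ∂centeredGaussian A = (T * A).trace := by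
  have hI := fun i j => integral_mul_centeredGaussian hA i j
  have hij : ∀ i j, Integrable (fun x : EuclideanSpace ℝ (Fin d) => T i j * (x i * x j))
      (centeredGaussian A) := fun i j => (hI i j).1.const_mul (T i j)
  calc ∫ x, quadForm T x ∂centeredGaussian A
      = ∫ x, ∑ i, ∑ j, T i j * (x i * x j) ∂centeredGaussian A := by simp only [quadForm_eq_sum]
    _ = ∑ i, ∫ x, ∑ j, T i j * (x i * x j) ∂centeredGaussian A :=
        integral_finsetSum _ fun i _ => integrable_finsetSum _ fun j _ => hij i j
    _ = ∑ i, ∑ j, T i j * A i j := by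
        refine Finset.sum_congr rfl fun i _ => ?_
        rw [integral_finsetSum _ fun j _ => hij i j]
        exact Finset.sum_congr rfl fun j _ => by rw [integral_const_mul, (hI i j).2]
    _ = (T * Aᵀ).trace := rfl
    _ = (T * A).trace := by rw [hA.transpose_eq]

theorem map_centeredGaussian {Z T : Matrix (Fin d) (Fin d) ℝ} (hZ : Z.PosDef) (hT : T.PosDef) :
    (centeredGaussian Z).map (toEuclideanCLM (𝕜 := ℝ) T) = centeredGaussian (T * Z * T) := by
  have : IsProbabilityMeasure ((centeredGaussian Z).map (toEuclideanCLM (𝕜 := ℝ) T)) :=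
    Measure.isProbabilityMeasure_map (by fun_prop)
  refine Measure.ext_of_charFun ?_
  ext t
  have h1 : charFun ((centeredGaussian Z).map (toEuclideanCLM (𝕜 := ℝ) T)) t
      = charFun (centeredGaussian Z) (toEuclideanCLM (𝕜 := ℝ) T t) := by
    rw [charFun_apply, integral_map (by fun_prop) (by fun_prop), charFun_apply]
    simp only [inner_toEuclideanCLM_left hT.transpose_eq]
  rw [h1, centeredGaussian, charFun_multivariateGaussian hZ.posSemidef, centeredGaussian,
    charFun_multivariateGaussian (hZ.conj_posDef hT).posSemidef, ← inner_toEuclideanCLM,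
    ← inner_toEuclideanCLM]
  have := quadForm_conj hT.transpose_eq Z t
  rw [quadForm, quadForm] at this
  rw [this]
  simp

/-- The logarithm of the Lebesgue density of `N(0, Z)`. -/
noncomputable def gaussianLogDensity (Z : Matrix (Fin d) (Fin d) ℝ)
    (x : EuclideanSpace ℝ (Fin d)) : ℝ :=
  -(d * Real.log (2 * Real.pi) + Real.log Z.det) / 2 - quadForm Z⁻¹ x / 2

theorem continuous_gaussianLogDensity (Z : Matrix (Fin d) (Fin d) ℝ) :
    Continuous (gaussianLogDensity Z) :=
  continuous_const.sub ((continuous_quadForm _).div_const 2)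

theorem gaussianLogDensity_one (x : EuclideanSpace ℝ (Fin d)) :
    gaussianLogDensity 1 x = -(d * Real.log (2 * Real.pi)) / 2 - ‖x‖ ^ 2 / 2 := by
  simp [gaussianLogDensity, quadForm_one]

/-- Both measures have the same characteristic function, by the Fourier transform of a Gaussian. -/
theorem stdGaussian_eq_withDensity :
    stdGaussian (EuclideanSpace ℝ (Fin d)) =
      volume.withDensity fun x => ENNReal.ofReal (Real.exp (gaussianLogDensity 1 x)) := by
  have hb : 0 < (1 / 2 : ℂ).re := by norm_num
  have hexp : ∀ (x : EuclideanSpace ℝ (Fin d)), ((Real.exp (gaussianLogDensity 1 x) : ℝ) : ℂ) =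
      Complex.exp (-(d * Real.log (2 * Real.pi)) / 2 : ℝ) *
        Complex.exp (-(1 / 2) * ‖x‖ ^ 2 + 0 * ⟪(0 : EuclideanSpace ℝ (Fin d)), x⟫) := by
    intro x
    rw [gaussianLogDensity_one, ← Complex.exp_add, Complex.ofReal_exp]
    congr 1
    push_cast
    ring
  have hint : Integrable (fun x : EuclideanSpace ℝ (Fin d) =>
      Real.exp (gaussianLogDensity 1 x)) := by
    have h := ((GaussianFourier.integrable_cexp_neg_mul_sq_norm_add hb 0
      (0 : EuclideanSpace ℝ (Fin d))).const_mul
        (Complex.exp (-(d * Real.log (2 * Real.pi)) / 2 : ℝ)))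
    simp only [← hexp] at h
    exact h.re
  have := isFiniteMeasure_withDensity_ofReal hint.2
  refine Measure.ext_of_charFun ?_
  ext t
  have hm : Measurable fun x : EuclideanSpace ℝ (Fin d) =>
      ENNReal.ofReal (Real.exp (gaussianLogDensity 1 x)) :=
    (Real.continuous_exp.comp (continuous_gaussianLogDensity 1)).measurable.ennreal_ofReal
  rw [charFun_stdGaussian, charFun_apply, integral_withDensity_eq_integral_toReal_smul hm
    (Filter.Eventually.of_forall fun x => ENNReal.ofReal_lt_top)]
  have : ∀ x : EuclideanSpace ℝ (Fin d),
      (ENNReal.ofReal (Real.exp (gaussianLogDensity 1 x))).toReal • Complex.exp (⟪x, t⟫ * Complex.I)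
      = Complex.exp (-(d * Real.log (2 * Real.pi)) / 2 : ℝ) *
        Complex.exp (-(1 / 2) * ‖x‖ ^ 2 + Complex.I * ⟪t, x⟫) := by
    intro x
    rw [ENNReal.toReal_ofReal (Real.exp_pos _).le, Complex.real_smul, hexp, mul_assoc,
      ← Complex.exp_add, real_inner_comm t x]
    congr 2
    ring
  simp only [this]
  have hpi : (Real.pi / (1 / 2) : ℂ) = ((2 * Real.pi : ℝ) : ℂ) := by push_cast; ring
  rw [integral_const_mul, GaussianFourier.integral_cexp_neg_mul_sq_norm_add hb, hpi,
    Complex.cpow_def_of_ne_zero (by exact_mod_cast (by positivity)), ← Complex.ofReal_log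
    (by positivity), ← Complex.exp_add, ← Complex.exp_add, finrank_euclideanSpace_fin]
  congr 1
  rw [Complex.I_sq]
  push_cast
  ring

theorem det_toEuclideanCLM (R : Matrix (Fin d) (Fin d) ℝ) :
    LinearMap.det (toEuclideanCLM (𝕜 := ℝ) R : EuclideanSpace ℝ (Fin d) →ₗ[ℝ] _) = R.det := by
  rw [coe_toEuclideanCLM_eq_toEuclideanLin, toEuclideanLin_eq_toLin_orthonormal,
    LinearMap.det_toLin]

theorem centeredGaussian_eq_withDensity {Z : Matrix (Fin d) (Fin d) ℝ} (hZ : Z.PosDef) :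
    centeredGaussian Z =
      volume.withDensity fun x => ENNReal.ofReal (Real.exp (gaussianLogDensity Z x)) := by
  set R := CFC.sqrt Z with hR
  have hRp : R.PosDef := hZ.sqrt_posDef
  have hRR : R * R = Z := hZ.sqrt_mul_sqrt
  set L := toEuclideanCLM (𝕜 := ℝ) R with hL
  have hLm : Measurable L := by fun_prop
  -- The standard density written in the image coordinate of `L`, still without the Jacobian factor
  -- `(det Z)^{-½}`.
  set h : EuclideanSpace ℝ (Fin d) → ℝ≥0∞ := fun x =>
    ENNReal.ofReal (Real.exp (-(d * Real.log (2 * Real.pi)) / 2 - quadForm Z⁻¹ x / 2)) with hh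
  have hhm : Measurable h := (Real.continuous_exp.comp (continuous_const.sub
    ((continuous_quadForm _).div_const 2))).measurable.ennreal_ofReal
  have hRZR : R * Z⁻¹ * R = 1 := by
    rw [← hRR, Matrix.mul_inv_rev, ← Matrix.mul_assoc, mul_nonsing_inv _ hRp.isUnit_det, one_mul,
      nonsing_inv_mul _ hRp.isUnit_det]
  have e1 : (fun x => ENNReal.ofReal (Real.exp (gaussianLogDensity 1 x))) = h ∘ L := by
    ext x
    simp only [hh, Function.comp_apply, hL]
    rw [quadForm_conj hRp.transpose_eq, hRZR, quadForm_one, gaussianLogDensity_one]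
  have e2 : (volume.withDensity (h ∘ L)).map L = (volume.map L).withDensity h := by
    ext s hs
    rw [Measure.map_apply hLm hs, withDensity_apply _ (hLm hs), withDensity_apply _ hs,
      setLIntegral_map hs hhm hLm]
    rfl
  have hdet : |(LinearMap.det (L : EuclideanSpace ℝ (Fin d) →ₗ[ℝ] _))⁻¹|
      = Real.exp (-Real.log Z.det / 2) := by
    rw [hL, det_toEuclideanCLM, abs_of_pos (inv_pos.2 hRp.det_pos), ← hRR, det_mul,
      Real.log_mul hRp.det_pos.ne' hRp.det_pos.ne', ← Real.exp_log hRp.det_pos, ← Real.exp_neg,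
      Real.log_exp]
    congr 1
    ring
  have e3 : (volume : Measure (EuclideanSpace ℝ (Fin d))).map L
      = ENNReal.ofReal (Real.exp (-Real.log Z.det / 2)) • volume := by
    rw [← hdet]
    refine Measure.map_linearMap_addHaar_eq_smul_addHaar volume ?_
    rw [hL, det_toEuclideanCLM]
    exact hRp.det_pos.ne'
  have e4 : centeredGaussian Z = (stdGaussian (EuclideanSpace ℝ (Fin d))).map L := by
    rw [centeredGaussian, multivariateGaussian]
    simp [hL, hR]
  rw [e4, stdGaussian_eq_withDensity, e1, e2, e3, withDensity_smul_measure,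
    ← withDensity_smul _ hhm]
  congr 1
  ext x
  simp only [hh, Pi.smul_apply, smul_eq_mul]
  rw [← ENNReal.ofReal_mul (Real.exp_pos _).le, ← Real.exp_add, gaussianLogDensity]
  congr 2
  ring

end WBary

/-! ### Wasserstein distance and entropy bounds. -/

namespace WBary

open Matrix
open scoped RealInnerProductSpace

variable {d n : ℕ}

/-- Expand `‖T^½ x - T^{-½} y‖² ≥ 0`. This makes the two quadratic functions an admissible pair of
Kantorovich potentials. -/
theorem norm_sq_sub_quadForm_add_le {T : Matrix (Fin d) (Fin d) ℝ} (hT : T.PosDef)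
    (x y : EuclideanSpace ℝ (Fin d)) :
    (‖x‖ ^ 2 - quadForm T x) + (‖y‖ ^ 2 - quadForm T⁻¹ y) ≤ ‖x - y‖ ^ 2 := by
  set R := CFC.sqrt T with hR
  have hRp : R.PosDef := hT.sqrt_posDef
  have hRR : R * R = T := hT.sqrt_mul_sqrt
  have hx := norm_toEuclideanCLM_sq hRp.transpose_eq x
  have hy := norm_toEuclideanCLM_sq hRp.inv.transpose_eq y
  have hxy : ⟪toEuclideanCLM (𝕜 := ℝ) R x, toEuclideanCLM (𝕜 := ℝ) R⁻¹ y⟫ = ⟪x, y⟫ := by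
    rw [inner_toEuclideanCLM_left hRp.transpose_eq, ← ContinuousLinearMap.comp_apply,
      ← ContinuousLinearMap.mul_def, ← map_mul, mul_nonsing_inv _ hRp.isUnit_det, map_one,
      one_apply_eq_self]
  have h := sq_nonneg ‖toEuclideanCLM (𝕜 := ℝ) R x - toEuclideanCLM (𝕜 := ℝ) R⁻¹ y‖
  rw [norm_sub_sq_real, hxy, hx, hy, ← Matrix.mul_inv_rev, hRR] at h
  rw [norm_sub_sq_real]
  linarith

/-- Weak Kantorovich duality: integrate the pointwise bound against any plan. -/
theorem ofReal_le_W2sq {μ ν : Measure (EuclideanSpace ℝ (Fin d))}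
    (hμ : Integrable (fun x => ‖x‖ ^ 2) μ) (hν : Integrable (fun x => ‖x‖ ^ 2) ν)
    {T : Matrix (Fin d) (Fin d) ℝ} (hT : T.PosDef) :
    ENNReal.ofReal (∫ x, (‖x‖ ^ 2 - quadForm T x) ∂μ + ∫ y, (‖y‖ ^ 2 - quadForm T⁻¹ y) ∂ν)
      ≤ W2sq μ ν := by
  refine le_iInf₂ fun π hπ => ?_
  have h1 : Integrable (fun x => ‖x‖ ^ 2 - quadForm T x) (π.map Prod.fst) := by
    rw [hπ.1]; exact hμ.sub (integrable_quadForm hμ T)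
  have h2 : Integrable (fun x => ‖x‖ ^ 2 - quadForm T⁻¹ x) (π.map Prod.snd) := by
    rw [hπ.2]; exact hν.sub (integrable_quadForm hν T⁻¹)
  have i1 := h1.comp_measurable measurable_fst
  have i2 := h2.comp_measurable measurable_snd
  have e : ∫ x, (‖x‖ ^ 2 - quadForm T x) ∂μ + ∫ y, (‖y‖ ^ 2 - quadForm T⁻¹ y) ∂ν
      = ∫ z, ((‖z.1‖ ^ 2 - quadForm T z.1) + (‖z.2‖ ^ 2 - quadForm T⁻¹ z.2)) ∂π := by
    refine Eq.trans ?_ (integral_add i1 i2).symm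
    congr 1
    · rw [← hπ.1, integral_map measurable_fst.aemeasurable h1.aestronglyMeasurable]; rfl
    · rw [← hπ.2, integral_map measurable_snd.aemeasurable h2.aestronglyMeasurable]; rfl
  rw [e]
  -- The dual integrand may be negative, so it is replaced by its positive part before passing to
  -- `lintegral`.
  refine (ENNReal.ofReal_le_ofReal (integral_mono (i1.add i2) (i1.add i2).pos_part
    fun z => le_max_left _ _)).trans ?_
  rw [ofReal_integral_eq_lintegral_ofReal (i1.add i2).pos_part
    (Filter.Eventually.of_forall fun z => le_max_right _ _)]
  exact lintegral_mono fun z => ENNReal.ofReal_le_ofReal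
    (max_le (norm_sq_sub_quadForm_add_le hT z.1 z.2) (by positivity))

/-- One matrix `T` serves twice: the plan `(x, T x)` bounds from above, the potentials built from
`T` bound from below. -/
theorem W2sq_centeredGaussian {Z A : Matrix (Fin d) (Fin d) ℝ} (hZ : Z.PosDef) (hA : A.PosDef) :
    W2sq (centeredGaussian Z) (centeredGaussian A) = ENNReal.ofReal (Z.trace + A.trace
      - 2 * (CFC.sqrt (CFC.sqrt A * Z * CFC.sqrt A)).trace) := by
  obtain ⟨T, hT, htr⟩ := exists_isTransport hZ hA
  have iZ := integrable_norm_sq_centeredGaussian Z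
  have iA := integrable_norm_sq_centeredGaussian A
  have hsq : ∀ B : Matrix (Fin d) (Fin d) ℝ, B.PosDef →
      ∫ x, ‖x‖ ^ 2 ∂centeredGaussian B = B.trace := fun B hB => by
    have := integral_quadForm_centeredGaussian hB 1
    simpa only [quadForm_one, one_mul] using this
  rw [← htr]
  apply le_antisymm
  · set L := toEuclideanCLM (𝕜 := ℝ) T
    have hm : Measurable fun x : EuclideanSpace ℝ (Fin d) => (x, L x) := by fun_prop
    have hplan : (centeredGaussian Z).map (fun x => (x, L x)) ∈
        transportPlans (centeredGaussian Z) (centeredGaussian A) := by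
      refine ⟨?_, ?_⟩
      · rw [Measure.map_map measurable_fst hm]
        exact Measure.map_id
      · rw [Measure.map_map measurable_snd hm, ← hT.conj, ← map_centeredGaussian hZ hT.posDef]
        rfl
    refine (iInf₂_le _ hplan).trans ?_
    rw [lintegral_map (by fun_prop) hm]
    have hsub : (1 - T)ᵀ = 1 - T := by rw [transpose_sub, transpose_one, hT.posDef.transpose_eq]
    have hcost : ∀ x, ‖x - L x‖ ^ 2 = quadForm ((1 - T) * (1 - T)) x := fun x => by
      rw [← norm_toEuclideanCLM_sq hsub, map_sub, map_one]
      rfl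
    have hnn : ∀ x, 0 ≤ quadForm ((1 - T) * (1 - T)) x := fun x => by
      rw [← hcost]; positivity
    simp only [hcost]
    rw [← ofReal_integral_eq_lintegral_ofReal (integrable_quadForm iZ _)
      (Filter.Eventually.of_forall hnn), integral_quadForm_centeredGaussian hZ]
    refine ENNReal.ofReal_le_ofReal (le_of_eq ?_)
    have : (T * (T * Z)).trace = A.trace := by rw [trace_mul_comm, ← hT.conj]
    simp only [sub_mul, Matrix.mul_sub, one_mul, mul_one, trace_sub, Matrix.mul_assoc, this]
    ring
  · refine le_trans (ENNReal.ofReal_le_ofReal (le_of_eq ?_)) (ofReal_le_W2sq iZ iA hT.posDef)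
    rw [integral_sub iZ (integrable_quadForm iZ _), integral_sub iA (integrable_quadForm iA _),
      hsq Z hZ, hsq A hA, integral_quadForm_centeredGaussian hZ,
      integral_quadForm_centeredGaussian hA, hT.inv_mul, trace_mul_comm Z]
    ring

theorem trace_add_trace_sub_nonneg {Z A : Matrix (Fin d) (Fin d) ℝ} (hZ : Z.PosDef)
    (hA : A.PosDef) :
    0 ≤ Z.trace + A.trace - 2 * (CFC.sqrt (CFC.sqrt A * Z * CFC.sqrt A)).trace := by
  have := two_mul_trace_sqrt_le hZ hA PosDef.one
  rw [inv_one, one_mul, one_mul] at this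
  linarith

theorem integrable_gaussianLogDensity {μ : Measure (EuclideanSpace ℝ (Fin d))}
    [IsFiniteMeasure μ] (hμ : Integrable (fun x => ‖x‖ ^ 2) μ) (Z : Matrix (Fin d) (Fin d) ℝ) :
    Integrable (gaussianLogDensity Z) μ :=
  (integrable_const _).sub ((integrable_quadForm hμ _).div_const 2)

theorem integral_gaussianLogDensity {μ : Measure (EuclideanSpace ℝ (Fin d))}
    [IsProbabilityMeasure μ] (hμ : Integrable (fun x => ‖x‖ ^ 2) μ)
    (Z : Matrix (Fin d) (Fin d) ℝ) :
    ∫ x, gaussianLogDensity Z x ∂μ =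
      -(d * Real.log (2 * Real.pi) + Real.log Z.det) / 2 - (∫ x, quadForm Z⁻¹ x ∂μ) / 2 := by
  unfold gaussianLogDensity
  rw [integral_sub (integrable_const _) ((integrable_quadForm hμ _).div_const 2), integral_const,
    integral_div]
  simp

/-- This is `1 + u ≤ exp u` at `u = l - log p`, times `p`. For two probability densities the extra
`-p + exp l` integrates to zero, so the relative entropy gets a pointwise nonnegative integrand. -/
theorem mul_log_sub_nonneg {p : ℝ} (hp : 0 ≤ p) (l : ℝ) :
    0 ≤ p * Real.log p - p * l - p + Real.exp l := by
  rcases hp.eq_or_lt with rfl | hp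
  · simpa using (Real.exp_pos l).le
  · have h := mul_le_mul_of_nonneg_left (Real.add_one_le_exp (l - Real.log p)) hp.le
    rw [Real.exp_sub, Real.exp_log hp, mul_div_cancel₀ _ hp.ne'] at h
    linarith

theorem eq_exp_of_mul_log_sub_eq_zero {p : ℝ} (hp : 0 ≤ p) {l : ℝ}
    (h0 : p * Real.log p - p * l - p + Real.exp l = 0) : p = Real.exp l := by
  rcases hp.eq_or_lt with rfl | hp
  · simp at h0
  · by_contra hne
    have hl : l - Real.log p ≠ 0 := fun h => hne (by rw [sub_eq_zero.1 h, Real.exp_log hp])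
    have h := mul_lt_mul_of_pos_left (Real.add_one_lt_exp hl) hp
    rw [Real.exp_sub, Real.exp_log hp, mul_div_cancel₀ _ hp.ne'] at h
    linarith

/-- Gibbs' inequality: relative entropy with respect to `N(0, X)` is nonnegative, and vanishes only
at `N(0, X)`. -/
theorem integral_gaussianLogDensity_le_entropy {μ : Measure (EuclideanSpace ℝ (Fin d))}
    [IsProbabilityMeasure μ] (hμ : Integrable (fun x => ‖x‖ ^ 2) μ) (hac : μ ≪ volume)
    (hint : Integrable (fun x => density μ x * Real.log (density μ x)) volume)
    {X : Matrix (Fin d) (Fin d) ℝ} (hX : X.PosDef) :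
    ∫ x, gaussianLogDensity X x ∂μ ≤ ∫ x, density μ x * Real.log (density μ x) ∧
    (∫ x, density μ x * Real.log (density μ x) ≤ ∫ x, gaussianLogDensity X x ∂μ →
      μ = centeredGaussian X) := by
  have hd0 : ∀ x, 0 ≤ density μ x := fun x => ENNReal.toReal_nonneg
  have iL : Integrable (fun x => density μ x * gaussianLogDensity X x) volume :=
    (integrable_rnDeriv_smul_iff hac).2 (integrable_gaussianLogDensity hμ X)
  have eL : ∫ x, density μ x * gaussianLogDensity X x = ∫ x, gaussianLogDensity X x ∂μ :=
    integral_rnDeriv_smul hac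
  have iD : Integrable (density μ) volume := Measure.integrable_toReal_rnDeriv
  have eD : ∫ x, density μ x = 1 := by
    have := Measure.integral_toReal_rnDeriv hac
    simpa [density] using this
  have hlm : Measurable fun x => Real.exp (gaussianLogDensity X x) :=
    (Real.continuous_exp.comp (continuous_gaussianLogDensity X)).measurable
  have hmass : ∫⁻ x, ENNReal.ofReal (Real.exp (gaussianLogDensity X x)) = 1 := by
    have h : centeredGaussian X Set.univ = 1 := measure_univ
    rwa [centeredGaussian_eq_withDensity hX, withDensity_apply _ MeasurableSet.univ,
      Measure.restrict_univ] at h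
  have iG : Integrable (fun x => Real.exp (gaussianLogDensity X x)) volume :=
    ⟨hlm.aestronglyMeasurable, (hasFiniteIntegral_iff_ofReal
      (Filter.Eventually.of_forall fun x => (Real.exp_pos _).le)).2 (by simp [hmass])⟩
  have eG : ∫ x, Real.exp (gaussianLogDensity X x) = 1 := by
    rw [integral_eq_lintegral_of_nonneg_ae
      (Filter.Eventually.of_forall fun x => (Real.exp_pos _).le) hlm.aestronglyMeasurable, hmass]
    rfl
  set g : EuclideanSpace ℝ (Fin d) → ℝ := fun x => density μ x * Real.log (density μ x)
    - density μ x * gaussianLogDensity X x - density μ x + Real.exp (gaussianLogDensity X x)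
  have hg0 : ∀ x, 0 ≤ g x := fun x => mul_log_sub_nonneg (hd0 x) _
  have ig : Integrable g volume := ((hint.sub iL).sub iD).add iG
  have eg : ∫ x, g x = (∫ x, density μ x * Real.log (density μ x))
      - ∫ x, gaussianLogDensity X x ∂μ := by
    have h1 := integral_add ((hint.sub iL).sub iD) iG
    have h2 := integral_sub (hint.sub iL) iD
    have h3 := integral_sub hint iL
    simp only [Pi.sub_apply] at h1 h2
    simp only [g]
    rw [h1, h2, h3, eL, eD, eG]
    ring
  refine ⟨by linarith [integral_nonneg (μ := volume) (f := g) hg0], fun hle => ?_⟩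
  have hz : ∫ x, g x = 0 := le_antisymm (by linarith) (integral_nonneg hg0)
  have hae := (integral_eq_zero_iff_of_nonneg hg0 ig).1 hz
  rw [centeredGaussian_eq_withDensity hX, ← Measure.withDensity_rnDeriv_eq μ volume hac]
  refine withDensity_congr_ae ?_
  filter_upwards [hae, Measure.rnDeriv_lt_top μ volume] with x hx hlt
  rw [← eq_exp_of_mul_log_sub_eq_zero (hd0 x) hx, density, ENNReal.ofReal_toReal hlt.ne]

theorem boltzmannEntropy_centeredGaussian {Z : Matrix (Fin d) (Fin d) ℝ} (hZ : Z.PosDef) :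
    boltzmannEntropy (centeredGaussian Z) = ((-(d * Real.log (2 * Real.pi * Real.exp 1)
      + Real.log Z.det) / 2 : ℝ) : EReal) := by
  have hlm : Measurable fun x => ENNReal.ofReal (Real.exp (gaussianLogDensity Z x)) :=
    (Real.continuous_exp.comp (continuous_gaussianLogDensity Z)).measurable.ennreal_ofReal
  have hac : centeredGaussian Z ≪ volume := by
    rw [centeredGaussian_eq_withDensity hZ]
    exact withDensity_absolutelyContinuous _ _
  have hd : density (centeredGaussian Z) =ᵐ[volume]
      fun x => Real.exp (gaussianLogDensity Z x) := by
    have h := Measure.rnDeriv_withDensity volume hlm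
    rw [← centeredGaussian_eq_withDensity hZ] at h
    filter_upwards [h] with x hx
    rw [density, hx, ENNReal.toReal_ofReal (Real.exp_pos _).le]
  have iZ := integrable_norm_sq_centeredGaussian Z
  have hcongr : (fun x => density (centeredGaussian Z) x *
      Real.log (density (centeredGaussian Z) x)) =ᵐ[volume]
      fun x => density (centeredGaussian Z) x * gaussianLogDensity Z x := by
    filter_upwards [hd] with x hx
    rw [hx, Real.log_exp]
  have iL : Integrable (fun x => density (centeredGaussian Z) x * gaussianLogDensity Z x) volume :=
    (integrable_rnDeriv_smul_iff hac).2 (integrable_gaussianLogDensity iZ Z)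
  have eL : ∫ x, density (centeredGaussian Z) x * gaussianLogDensity Z x
      = ∫ x, gaussianLogDensity Z x ∂centeredGaussian Z := integral_rnDeriv_smul hac
  rw [boltzmannEntropy, if_pos ⟨hac, iL.congr hcongr.symm⟩, integral_congr_ae hcongr, eL,
    integral_gaussianLogDensity iZ, integral_quadForm_centeredGaussian hZ,
    nonsing_inv_mul _ hZ.isUnit_det, trace_one, Fintype.card_fin,
    Real.log_mul (by positivity) (Real.exp_pos 1).ne', Real.log_exp]
  congr 1
  ring

end WBary

/-! ### Minimization over measures. -/

namespace WBary

open Matrix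
open scoped RealInnerProductSpace

variable {d n : ℕ} {w : Fin n → ℝ} {A : Fin n → Matrix (Fin d) (Fin d) ℝ} {γ : ℝ}

theorem penalizedObjective_centeredGaussian (hw : ∀ i, 0 ≤ w i) (hw1 : ∑ i, w i = 1)
    (hA : ∀ i, (A i).PosDef) {Z : Matrix (Fin d) (Fin d) ℝ} (hZ : Z.PosDef) :
    penalizedObjective w (fun i => centeredGaussian (A i)) γ (centeredGaussian Z)
      = ((1 / 2 * matrixObjective w A γ Z : ℝ) : EReal) := by
  have h0 := fun i => trace_add_trace_sub_nonneg hZ (hA i)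
  have hsum : ∑ i, ENNReal.ofReal (w i / 2) * W2sq (centeredGaussian Z) (centeredGaussian (A i))
      = ENNReal.ofReal (∑ i, w i / 2 * (Z.trace + (A i).trace
        - 2 * (CFC.sqrt (CFC.sqrt (A i) * Z * CFC.sqrt (A i))).trace)) := by
    rw [ENNReal.ofReal_sum_of_nonneg fun i _ => mul_nonneg (by linarith [hw i]) (h0 i)]
    refine Finset.sum_congr rfl fun i _ => ?_
    rw [W2sq_centeredGaussian hZ (hA i), ENNReal.ofReal_mul (by linarith [hw i])]
  rw [penalizedObjective, hsum, boltzmannEntropy_centeredGaussian hZ, EReal.coe_ennreal_ofReal,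
    max_eq_left (Finset.sum_nonneg fun i _ => mul_nonneg (by linarith [hw i]) (h0 i)),
    ← EReal.coe_mul, ← EReal.coe_add, matrixObjective_eq hw1]
  congr 1
  have e : ∑ i, w i / 2 * (Z.trace + (A i).trace
        - 2 * (CFC.sqrt (CFC.sqrt (A i) * Z * CFC.sqrt (A i))).trace)
      = ∑ i, w i * (Z.trace / 2) + 1 / 2 * ∑ i, w i * (A i).trace
        - ∑ i, w i * (CFC.sqrt (CFC.sqrt (A i) * Z * CFC.sqrt (A i))).trace := by
    rw [Finset.mul_sum, ← Finset.sum_add_distrib, ← Finset.sum_sub_distrib]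
    exact Finset.sum_congr rfl fun i _ => by ring
  rw [e, ← Finset.sum_mul, hw1]
  ring

theorem integral_quadForm_sum_add_smul {μ : Measure (EuclideanSpace ℝ (Fin d))}
    (hμ : Integrable (fun x => ‖x‖ ^ 2) μ) (w : Fin n → ℝ)
    (T : Fin n → Matrix (Fin d) (Fin d) ℝ) (γ : ℝ) (S : Matrix (Fin d) (Fin d) ℝ) :
    ∫ x, quadForm (∑ i, w i • T i + γ • S) x ∂μ
      = ∑ i, w i * ∫ x, quadForm (T i) x ∂μ + γ * ∫ x, quadForm S x ∂μ := by
  have e : ∀ x : EuclideanSpace ℝ (Fin d), quadForm (∑ i, w i • T i + γ • S) x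
      = ∑ i, w i * quadForm (T i) x + γ * quadForm S x := fun x => by
    simp [quadForm, inner_add_right, inner_sum, inner_smul_right]
  simp only [e]
  have hT := fun i => (integrable_quadForm hμ (T i)).const_mul (w i)
  rw [integral_add (integrable_finsetSum _ fun i _ => hT i)
    ((integrable_quadForm hμ S).const_mul γ), integral_finsetSum _ fun i _ => hT i]
  simp only [integral_const_mul]

/-- The dual lower bound for the objective: it dominates the value at `N(0, X)`, strictly so at all
other measures. -/
theorem SolvesBarycenterEq.le_penalizedObjective (hw : ∀ i, 0 ≤ w i) (hw1 : ∑ i, w i = 1)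
    (hγ : 0 < γ) (hA : ∀ i, (A i).PosDef) {X : Matrix (Fin d) (Fin d) ℝ} (hX : X.PosDef)
    (h : SolvesBarycenterEq w A γ X) {μ : Measure (EuclideanSpace ℝ (Fin d))} (hμ : μ ∈ P2 d) :
    ((1 / 2 * matrixObjective w A γ X : ℝ) : EReal)
        ≤ penalizedObjective w (fun i => centeredGaussian (A i)) γ μ ∧
    (penalizedObjective w (fun i => centeredGaussian (A i)) γ μ
        ≤ ((1 / 2 * matrixObjective w A γ X : ℝ) : EReal) → μ = centeredGaussian X) := by
  have : IsProbabilityMeasure μ := hμ.1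
  have hm := integrable_norm_sq_of_mem_P2 hμ
  by_cases hE : μ ≪ volume ∧ Integrable (fun x => density μ x * Real.log (density μ x)) volume
  swap
  · have htop : penalizedObjective w (fun i => centeredGaussian (A i)) γ μ = ⊤ := by
      rw [penalizedObjective, boltzmannEntropy, if_neg hE, EReal.coe_mul_top_of_pos hγ,
        EReal.add_top_of_ne_bot (EReal.coe_ennreal_ne_bot _)]
    rw [htop]
    exact ⟨le_top, fun hle => absurd (top_le_iff.1 hle) (EReal.coe_ne_top _)⟩
  obtain ⟨T, hT⟩ := exists_transports hA hX
  -- The dual lower bound on `W₂²(μ, μᵢ)` given by the transport from `N(0, X)`, not from `μ`.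
  set c : Fin n → ℝ := fun i => ∫ x, (‖x‖ ^ 2 - quadForm (T i) x) ∂μ
    + ∫ y, (‖y‖ ^ 2 - quadForm (T i)⁻¹ y) ∂centeredGaussian (A i) with hc
  set q : Fin n → ℝ := fun i => ∫ x, quadForm (T i) x ∂μ with hq
  set E := ∫ x, density μ x * Real.log (density μ x) with hEdef
  have hsum : ENNReal.ofReal (∑ i, w i / 2 * c i) ≤
      ∑ i, ENNReal.ofReal (w i / 2) * W2sq μ (centeredGaussian (A i)) := by
    refine (Finset.le_sum_of_subadditive ENNReal.ofReal ENNReal.ofReal_zero.le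
      (fun _ _ => ENNReal.ofReal_add_le) _ _).trans (Finset.sum_le_sum fun i _ => ?_)
    rw [ENNReal.ofReal_mul (by linarith [hw i])]
    gcongr
    exact ofReal_le_W2sq hm (integrable_norm_sq_centeredGaussian _) (hT i).posDef
  have hlow : ((∑ i, w i / 2 * c i + γ * E : ℝ) : EReal) ≤
      penalizedObjective w (fun i => centeredGaussian (A i)) γ μ := by
    rw [penalizedObjective, boltzmannEntropy, if_pos hE, EReal.coe_add, EReal.coe_mul]
    refine add_le_add_left ?_ _
    refine le_trans ?_ (EReal.coe_ennreal_le_coe_ennreal_iff.2 hsum)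
    rw [EReal.coe_ennreal_ofReal]
    exact_mod_cast le_max_left _ _
  -- Stationarity of `X`: tested against `μ` and against `X`, it gives the identities `hmq` and
  -- `htr` behind the cancellation.
  have h1 : (1 : Matrix (Fin d) (Fin d) ℝ) = ∑ i, w i • T i + γ • X⁻¹ := by
    have := (solvesBarycenterEq_iff hX hT).1 h
    rwa [sub_sub, sub_eq_zero] at this
  have hmq : ∫ x, ‖x‖ ^ 2 ∂μ = ∑ i, w i * q i + γ * ∫ x, quadForm X⁻¹ x ∂μ := by
    rw [← integral_quadForm_sum_add_smul hm w T γ X⁻¹, ← h1]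
    simp only [quadForm_one]
  have htr : X.trace = ∑ i, w i * (T i * X).trace + γ * d := by
    have := congrArg (fun M => (M * X).trace) h1
    simpa [add_mul, Finset.sum_mul, trace_sum, nonsing_inv_mul _ hX.isUnit_det] using this
  have hci : ∀ i, c i = ∫ x, ‖x‖ ^ 2 ∂μ - q i + ((A i).trace - (T i * X).trace) := fun i => by
    have iA := integrable_norm_sq_centeredGaussian (A i)
    have hA1 : ∫ x, ‖x‖ ^ 2 ∂centeredGaussian (A i) = (A i).trace := by
      have := integral_quadForm_centeredGaussian (hA i) 1
      simpa only [quadForm_one, one_mul] using this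
    simp only [hc]
    rw [integral_sub hm (integrable_quadForm hm _), integral_sub iA (integrable_quadForm iA _), hA1,
      integral_quadForm_centeredGaussian (hA i), (hT i).inv_mul, trace_mul_comm X]
  have hcsum : ∑ i, w i / 2 * c i = (∫ x, ‖x‖ ^ 2 ∂μ - ∑ i, w i * q i
      + (∑ i, w i * (A i).trace - ∑ i, w i * (T i * X).trace)) / 2 := by
    have : ∑ i, w i / 2 * c i = ∑ i, (w i * ((∫ x, ‖x‖ ^ 2 ∂μ) / 2) - w i * q i / 2
        + (w i * (A i).trace / 2 - w i * (T i * X).trace / 2)) :=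
      Finset.sum_congr rfl fun i _ => by rw [hci]; ring
    rw [this, Finset.sum_add_distrib, Finset.sum_sub_distrib, Finset.sum_sub_distrib,
      ← Finset.sum_mul, hw1, ← Finset.sum_div, ← Finset.sum_div, ← Finset.sum_div]
    ring
  -- All dependence on `μ` has disappeared.
  have hval : ∑ i, w i / 2 * c i + γ * ∫ x, gaussianLogDensity X x ∂μ
      = 1 / 2 * matrixObjective w A γ X := by
    have hs : ∑ i, w i * (CFC.sqrt (CFC.sqrt (A i) * X * CFC.sqrt (A i))).trace =
        ∑ i, w i * (T i * X).trace :=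
      Finset.sum_congr rfl fun i _ => by rw [(hT i).trace_eq hX (hA i)]
    rw [hcsum, integral_gaussianLogDensity hm, matrixObjective_eq hw1, hs, hmq, htr,
      Real.log_mul (by positivity) (Real.exp_pos 1).ne', Real.log_exp]
    ring
  obtain ⟨hle, heq⟩ := integral_gaussianLogDensity_le_entropy hm hE.1 hE.2 hX
  refine ⟨le_trans (EReal.coe_le_coe_iff.2 ?_) hlow, fun hJ => heq ?_⟩
  · rw [← hval]
    gcongr
  -- Only the entropy bound has to be tight to identify `μ`; since `γ > 0`, it can be isolated.
  · have := EReal.coe_le_coe_iff.1 (hlow.trans hJ)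
    rw [← hval] at this
    exact le_of_mul_le_mul_left (by linarith) hγ

theorem setOf_isMinOn_penalizedObjective (hw : ∀ i, 0 ≤ w i) (hw1 : ∑ i, w i = 1)
    (hγ : 0 < γ) (hA : ∀ i, (A i).PosDef) {X : Matrix (Fin d) (Fin d) ℝ} (hX : X.PosDef)
    (h : SolvesBarycenterEq w A γ X) {𝒜 : Set (Measure (EuclideanSpace ℝ (Fin d)))}
    (h𝒜 : 𝒜 ⊆ P2 d)
    (hG : ∀ Z : Matrix (Fin d) (Fin d) ℝ, Z.PosDef → centeredGaussian Z ∈ 𝒜) :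
    {μ ∈ 𝒜 | IsMinOn (penalizedObjective w (fun i => centeredGaussian (A i)) γ) 𝒜 μ}
      = {centeredGaussian X} := by
  have hval := penalizedObjective_centeredGaussian (γ := γ) hw hw1 hA hX
  ext μ
  constructor
  · rintro ⟨hμ, hmin⟩
    exact (h.le_penalizedObjective hw hw1 hγ hA hX (h𝒜 hμ)).2 (hval ▸ hmin (hG X hX))
  · rintro rfl
    refine ⟨hG X hX, fun ν hν => ?_⟩
    rw [Set.mem_ofPred_eq, hval]
    exact (h.le_penalizedObjective hw hw1 hγ hA hX (h𝒜 hν)).1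

/-! ### The closed form in dimension one. -/

theorem sqrt_apply_of_fin_one {M : Matrix (Fin 1) (Fin 1) ℝ} (hM : M.PosDef) (k : Fin 1) :
    CFC.sqrt M k k = √(M k k) := by
  have h := congrFun (congrFun hM.sqrt_mul_sqrt k) k
  rw [mul_apply, Fintype.sum_subsingleton _ k] at h
  rw [← h, Real.sqrt_mul_self hM.sqrt_posDef.diag_pos.le]

/-- The equation is the quadratic `u² - s u - γ = 0` for `u = √x`. -/
theorem SolvesBarycenterEq.apply_of_fin_one (hw : ∀ i, 0 ≤ w i) (hγ : 0 < γ)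
    {A : Fin n → Matrix (Fin 1) (Fin 1) ℝ} (hA : ∀ i, (A i).PosDef)
    {X : Matrix (Fin 1) (Fin 1) ℝ} (hX : X.PosDef) (h : SolvesBarycenterEq w A γ X) (k : Fin 1) :
    X k k = (∑ i, w i * √(A i k k) + √((∑ i, w i * √(A i k k)) ^ 2 + 4 * γ)) ^ 2 / 4 := by
  set s := ∑ i, w i * √(A i k k) with hs
  set u := √(X k k) with hu
  have hx : 0 < X k k := hX.diag_pos
  have hu0 : 0 < u := Real.sqrt_pos.2 hx
  have huu : u * u = X k k := Real.mul_self_sqrt hx.le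
  have hs0 : 0 ≤ s := Finset.sum_nonneg fun i _ => mul_nonneg (hw i) (Real.sqrt_nonneg _)
  have hterm : ∀ i, CFC.sqrt (CFC.sqrt X * A i * CFC.sqrt X) k k = u * √(A i k k) := fun i => by
    rw [sqrt_apply_of_fin_one ((hA i).conj_posDef hX.sqrt_posDef), mul_apply,
      Fintype.sum_subsingleton _ k, mul_apply, Fintype.sum_subsingleton _ k,
      sqrt_apply_of_fin_one hX, ← hu, mul_right_comm, Real.sqrt_mul (mul_self_nonneg u),
      Real.sqrt_mul_self hu0.le]
  have heq : u * u - γ = u * s := by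
    have := congrFun (congrFun h k) k
    simp only [Matrix.sub_apply, Matrix.smul_apply, one_apply_eq, smul_eq_mul, mul_one,
      Matrix.sum_apply, hterm] at this
    rw [huu, this, hs, Finset.mul_sum]
    exact Finset.sum_congr rfl fun i _ => by ring
  -- Since `u (u - s) = γ > 0`, `u` is the larger root.
  have hle : 0 ≤ 2 * u - s := by
    have : 0 < u - s := pos_of_mul_pos_right (a := u) (by linarith [mul_sub u u s]) hu0.le
    linarith
  have hroot : √(s ^ 2 + 4 * γ) = 2 * u - s := by
    rw [← Real.sqrt_sq hle]
    congr 1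
    linarith [show (2 * u - s) ^ 2 = 4 * (u * u - u * s) + s ^ 2 by ring]
  rw [hroot, ← huu]
  ring

end WBary

theorem theorem3p1 {d n : ℕ} (w : Fin n → ℝ) (hw : ∀ i, 0 ≤ w i) (hw1 : ∑ i, w i = 1)
    (γ : ℝ) (hγ : 0 < γ) (A : Fin n → Matrix (Fin d) (Fin d) ℝ) (hA : ∀ i, (A i).PosDef) :
    ∃ X : Matrix (Fin d) (Fin d) ℝ,
      -- `X` is the positive definite solution of the matrix equation, and it is the only one
      (X.PosDef ∧ WBary.SolvesBarycenterEq w A γ X) ∧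
      (∀ Y : Matrix (Fin d) (Fin d) ℝ, Y.PosDef → WBary.SolvesBarycenterEq w A γ Y → Y = X) ∧
      -- `N(0, X)` is the unique minimizer over every class `𝒜` of measures with finite second
      -- moments that contains the nondegenerate centered Gaussians
      (∀ 𝒜 : Set (Measure (EuclideanSpace ℝ (Fin d))), 𝒜 ⊆ WBary.P2 d →
        (∀ Z : Matrix (Fin d) (Fin d) ℝ, Z.PosDef → WBary.centeredGaussian Z ∈ 𝒜) →
        {μ ∈ 𝒜 | IsMinOn
            (WBary.penalizedObjective w (fun i => WBary.centeredGaussian (A i)) γ) 𝒜 μ}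
          = {WBary.centeredGaussian X}) ∧
      -- on centered Gaussians the objective is half the reduced matrix objective
      (∀ Z : Matrix (Fin d) (Fin d) ℝ, Z.PosDef →
        WBary.penalizedObjective w (fun i => WBary.centeredGaussian (A i)) γ
            (WBary.centeredGaussian Z)
          = ((1 / 2 * WBary.matrixObjective w A γ Z : ℝ) : EReal)) ∧
      -- the reduced matrix objective is strictly convex
      StrictConvexOn ℝ {Z : Matrix (Fin d) (Fin d) ℝ | Z.PosDef}
        (WBary.matrixObjective w A γ) ∧
      -- closed form in dimension one
      (d = 1 → ∀ k : Fin d,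
        X k k = (∑ i, w i * √(A i k k) + √((∑ i, w i * √(A i k k)) ^ 2 + 4 * γ)) ^ 2 / 4) := by
  obtain ⟨X, hX, h⟩ := WBary.exists_solvesBarycenterEq hw hw1 hγ hA
  refine ⟨X, ⟨hX, h⟩, fun Y hY hY' => h.unique hw hw1 hγ hA hX hY hY',
    fun 𝒜 h𝒜 hG => WBary.setOf_isMinOn_penalizedObjective hw hw1 hγ hA hX h h𝒜 hG,
    fun Z hZ => WBary.penalizedObjective_centeredGaussian hw hw1 hA hZ,
    WBary.strictConvexOn_matrixObjective hw hw1 hγ hA, ?_⟩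
  rintro rfl k
  exact h.apply_of_fin_one hw hγ hA hX k
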